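/- **Setting.** Let $A_1,A_2,\dots$ be i.i.d. centered Gaussian processes indexed by $\mathbb R$, with continuous sample paths, stationary increments and $A_i(0)\equiv 0$. Write $A_i(s,t):=A_i(t)-A_i(s)$, and let $v$ be the variance function, $\operatorname{Var}A_i(s,t)=v(t-s)$ for $s\le t$. Assume that $\lim_{t\to\infty}v(t)/t^{\alpha}=0$ for some $\alpha<2$. Let $b>0$, $c_1>c_2>0$ and $t_0:=b/(c_1-c_2)$. For $n\in\mathbb N$ feed the sources $A_1,\dots,A_n$ into a tandem of two queues with service rates $nc_1$ and $nc_2$: the stationary content of the first queue at time $u$ is $Q_{1,n}(u)=\sup_{s\ge 0}\bigl(\sum_{i\le n}A_i(u-s,u)-nc_1s\bigr)$, its output in $(u,w]$ is $D_n(u,w)=\sum_{i\le n}A_i(u,w)+Q_{1,n}(u)-Q_{1,n}(w)$, and the stationary content of the second queue at time $0$ is $Q_{2,n}=\sup_{t\ge 0}\bigl(D_n(-t,0)-nc_2t\bigr)$. Put $$J:=-\lim_{n\to\infty}\frac1n\log\mathbb P(Q_{2,n}>nb).$$ For $s,t\in\mathbb R$ let $\Gamma(s,t):=\tfrac12\bigl(v(|t|)-v(|t-s|)+v(|s|)\bigr)$.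 Let $R$ be the reproducing kernel Hilbert space of functions on $\mathbb R$ with kernel $\Gamma$, i.e. the closure of the finite linear combinations $\sum_i a_i\Gamma(s_i,\cdot)$ under the norm $\|\sum_i a_i\Gamma(s_i,\cdot)\|_R^2=\sum_{i,j}a_ia_j\Gamma(s_i,s_j)$. Put $I(f):=\tfrac12\|f\|_R^2$ for $f\in R$ and $I(f):=\infty$ otherwise. Let $\mathcal X$ be the set of continuous $f:\mathbb R\to\mathbb R$ with $f(0)=0$ and $f(t)/(1+|t|)\to0$ as $t\to\pm\infty$. For $t>t_0$ and $s\in(0,t)$ let $$\mathcal U^{s,t}:=\{f\in\mathcal X:\ -f(-t)\ge b+c_2t,\ \ f(-s)-f(-t)\ge b+c_2t-c_1s\},$$ $$\Lambda(y,z):=\tfrac12\,(y,z)\begin{pmatrix}v(t)&\Gamma(t-s,t)\\ \Gamma(t-s,t)&v(t-s)\end{pmatrix}^{-1}(y,z)^{\top},\qquad k(s,t):=\frac{\Gamma(s,t)}{v(t)}\,(b+c_2t),$$ $$\Upsilon(s,t):=\begin{cases}\Lambda(b+c_2t,\;b+c_2t-c_1s)&\text{if }k(s,t)>c_1s,\\[2pt]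 \dfrac{(b+c_2t)^2}{2v(t)}&\text{if }k(s,t)\le c_1s.\end{cases}$$ **Statement.** Assume that $\sqrt{v}$ is strictly increasing and strictly concave on $[0,\infty)$ and twice continuously differentiable on $(0,\infty)$. Then 1. for all $t>t_0$ and $s\in(0,t)$, $\ \inf_{f\in\mathcal U^{s,t}}I(f)=\Upsilon(s,t)$; 2. the limit $J$ exists and is finite, and $$J\ \ge\ \inf_{t>t_0}\ \sup_{s\in(0,t)}\Upsilon(s,t).$$ -/

import Mathlib

open MeasureTheory ProbabilityTheory Filter Topology Set

noncomputable section

namespace Tandem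

/-! ### The Gaussian sources -/

/-- A centered Gaussian process `A` indexed by time in `ℝ`, with continuous sample paths,
stationary increments, `A 0 ≡ 0`, and variance function `v`. -/
structure IsGaussianSource {Ω : Type*} [MeasurableSpace Ω] (P : Measure Ω)
    (v : ℝ → ℝ) (A : ℝ → Ω → ℝ) : Prop where
  gaussian : IsGaussianProcess A P
  centered : ∀ t, ∫ ω, A t ω ∂P = 0
  start_zero : ∀ ω, A 0 ω = 0
  continuous_paths : ∀ ω, Continuous fun t => A t ω
  stationary_increments : ∀ h : ℝ,
    IdentDistrib (fun ω (t : ℝ) => A (h + t) ω - A h ω) (fun ω (t : ℝ) => A t ω) P P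
  variance_eq : ∀ s t : ℝ, s ≤ t → variance (fun ω => A t ω - A s ω) P = v (t - s)

/-- `A 0, A 1, …` are i.i.d. Gaussian sources with variance function `v`. -/
structure IsIIDGaussianSources {Ω : Type*} [MeasurableSpace Ω] (P : Measure Ω)
    (v : ℝ → ℝ) (A : ℕ → ℝ → Ω → ℝ) : Prop where
  source : ∀ i, IsGaussianSource P v (A i)
  indep : iIndepFun (fun i ω (t : ℝ) => A i t ω) P
  identDistrib : ∀ i j,
    IdentDistrib (fun ω (t : ℝ) => A i t ω) (fun ω (t : ℝ) => A j t ω) P P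

/-- Growth condition: `v(t) / t ^ α → 0` as `t → ∞`, for some `α < 2`. -/
def SubquadraticGrowth (v : ℝ → ℝ) : Prop :=
  ∃ α : ℝ, α < 2 ∧ Tendsto (fun t : ℝ => v t / t ^ α) atTop (𝓝 0)

/-- `√v` is strictly increasing and strictly concave on `[0, ∞)`, and twice continuously
differentiable at positive times (so that Brownian motion, `v t = t`, is included). -/
structure RegularVariance (v : ℝ → ℝ) : Prop where
  contDiffOn : ContDiffOn ℝ 2 (fun t => √(v t)) (Ioi 0)
  strictMonoOn : StrictMonoOn (fun t => √(v t)) (Ici 0)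
  strictConcaveOn : StrictConcaveOn ℝ (Ici 0) (fun t => √(v t))

/-! ### The tandem queue

`X u` is the cumulative input up to time `u` (so that `X w - X u` is the traffic offered in
`(u, w]`); `r₁` and `r₂` are the service rates of the two queues. The suprema are finite whenever
`r₁, r₂ > 0` and `X u / (1 + |u|) → 0` as `u → -∞`, which is almost surely the case
for sums of Gaussian sources whose variance function has subquadratic growth. -/

/-- Stationary content at time `u` of a queue with input `X` and service rate `r`:
`sup_{s ≥ 0} (X(u) - X(u - s) - r s)`. -/
def queue (r : ℝ) (X : ℝ → ℝ) (u : ℝ) : ℝ :=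
  ⨆ s : Ici (0 : ℝ), (X u - X (u - s) - r * s)

/-- Cumulative output (up to an additive constant) of a queue with input `X` and service rate
`r`: in `(u, w]` the output is the input in `(u, w]` minus the increase of the content. -/
def output (r : ℝ) (X : ℝ → ℝ) (u : ℝ) : ℝ :=
  X u - queue r X u

/-- Stationary content at time `u` of the second queue, whose input is the output of the first. -/
def secondQueue (r₁ r₂ : ℝ) (X : ℝ → ℝ) (u : ℝ) : ℝ :=
  queue r₂ (output r₁ X) u

/-- The stationary content (at time `0`) of the second queue when `n` sources are present and
the service rates are `n c₁` and `n c₂`. -/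
def Q2 {Ω : Type*} (A : ℕ → ℝ → Ω → ℝ) (c₁ c₂ : ℝ) (n : ℕ) (ω : Ω) : ℝ :=
  secondQueue (n * c₁) (n * c₂) (fun t => ∑ i ∈ Finset.range n, A i t ω) 0

/-- `J = - lim_{n → ∞} (1 / n) log (p n)`: the limit exists and is finite. The logarithm is
extended-real valued, with `log 0 = -∞`. -/
def IsDecayRate (p : ℕ → ENNReal) (J : ℝ) : Prop :=
  Tendsto (fun n : ℕ => -(ENNReal.log (p n) / (n : EReal))) atTop (𝓝 (J : EReal))

/-! ### Path space, reproducing kernel Hilbert space, and rate function -/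

/-- The covariance `Cov (A s, A t)` of a source, for all real `s` and `t`. -/
def Gam (v : ℝ → ℝ) (s t : ℝ) : ℝ :=
  (v |t| - v |t - s| + v |s|) / 2

/-- The path space: continuous `ω` with `ω(0) = 0` and `ω(t) / (1 + |t|) → 0` as `t → ±∞`. -/
def pathSpace : Set (ℝ → ℝ) :=
  {f | Continuous f ∧ f 0 = 0 ∧
    Tendsto (fun t => f t / (1 + |t|)) atTop (𝓝 0) ∧
    Tendsto (fun t => f t / (1 + |t|)) atBot (𝓝 0)}

/-- The element `∑ₛ c(s) Γ(s, ·)` of the pre-Hilbert space of finite combinations of the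
functions `Γ(s, ·)`. -/
def kernelComb (v : ℝ → ℝ) (c : ℝ →₀ ℝ) (t : ℝ) : ℝ :=
  c.sum fun s a => a * Gam v s t

/-- The norm of `∑ₛ c(s) Γ(s, ·)`: the square root of `∑ₛ ∑ᵣ c(s) c(r) Γ(s, r)`. -/
def kernelCombNorm (v : ℝ → ℝ) (c : ℝ →₀ ℝ) : ℝ :=
  √(c.sum fun s a => c.sum fun r a' => a * a' * Gam v s r)

/-- `f` is the limit of the finite combinations with coefficients `c 0, c 1, …`: these form a
Cauchy sequence in norm and converge pointwise to `f` (in a reproducing kernel Hilbert space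
norm limits are pointwise limits). -/
structure IsKernelLimit (v : ℝ → ℝ) (c : ℕ → ℝ →₀ ℝ) (f : ℝ → ℝ) : Prop where
  cauchy : ∀ ε : ℝ, 0 < ε → ∃ N : ℕ, ∀ m ≥ N, ∀ n ≥ N, kernelCombNorm v (c m - c n) < ε
  tendsto : ∀ t, Tendsto (fun n => kernelComb v (c n) t) atTop (𝓝 (f t))

/-- The reproducing kernel Hilbert space `R` of `Γ`, as a set of functions: the closure of the
finite combinations of the functions `Γ(s, ·)`. -/
def rkhs (v : ℝ → ℝ) : Set (ℝ → ℝ) :=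
  {f | ∃ c, IsKernelLimit v c f}

/-- The norm of `f` in `R`: the limit of the norms of approximating finite combinations (for `f`
in `R` this limit exists and is the same for all of them, so the infimum is over a singleton). -/
def rkhsNorm (v : ℝ → ℝ) (f : ℝ → ℝ) : ℝ :=
  sInf {x | ∃ c, IsKernelLimit v c f ∧ Tendsto (fun n => kernelCombNorm v (c n)) atTop (𝓝 x)}

open Classical in
/-- The rate function: `I(f) = ‖f‖_R² / 2` for `f ∈ R`, and `∞` otherwise. -/
def rate (v : ℝ → ℝ) (f : ℝ → ℝ) : EReal :=
  if f ∈ rkhs v then ((1 / 2 * rkhsNorm v f ^ 2 : ℝ) : EReal) else ⊤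

/-- The set `U^{s,t}`. -/
def pathSetU (b c₁ c₂ s t : ℝ) : Set (ℝ → ℝ) :=
  {f | f ∈ pathSpace ∧ b + c₂ * t ≤ -f (-t) ∧ b + c₂ * t - c₁ * s ≤ f (-s) - f (-t)}

/-! ### The explicit bound -/

/-- The covariance matrix of `(A t, A s)`. -/
def covMat (v : ℝ → ℝ) (s t : ℝ) : Matrix (Fin 2) (Fin 2) ℝ :=
  !![v t, Gam v s t; Gam v s t, v s]

/-- The bivariate Gaussian rate function of `(A(-t, 0), A(-t, -s))`:
`Λ(y, z) = ½ (y, z) Σ(t - s, t)⁻¹ (y, z)ᵀ`. -/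
def Lam (v : ℝ → ℝ) (s t y z : ℝ) : ℝ :=
  1 / 2 * (![y, z] ⬝ᵥ Matrix.mulVec (covMat v (t - s) t)⁻¹ ![y, z])

/-- `k(s, t) = E (A s | A t = b + c₂ t) = Γ(s, t) / v(t) * (b + c₂ t)`. -/
def kfun (v : ℝ → ℝ) (b c₂ s t : ℝ) : ℝ :=
  Gam v s t / v t * (b + c₂ * t)

open Classical in
/-- The function `Υ(s, t)`. -/
def Ups (v : ℝ → ℝ) (b c₁ c₂ s t : ℝ) : ℝ :=
  if c₁ * s < kfun v b c₂ s t then Lam v s t (b + c₂ * t) (b + c₂ * t - c₁ * s)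
  else (b + c₂ * t) ^ 2 / (2 * v t)

end Tandem

end

/-! No sample-path large deviation principle is used. Let X be the sum of n sources. Almost surely,
and up to a little slack, the second queue exceeds nb exactly when some t satisfies X(-s) - X(-t) ≥
n(b + c₂t - c₁s) for all s in [0, t]: the supremum in Q₁(0), which enters with a minus sign, becomes
"for all s", the other two merge into "some t" (`exists_forall_lt_of_lt_secondQueue`,
`lt_secondQueue_of_forall_le`).

For fixed t this is a `pathEvent`. Independent blocks of n and m sources that meet their own
barriers together meet the summed barrier, so its probability is supermultiplicative in the number
of sources (`pathProb_mul_le`). A bound exp(-NR) from below at a single N therefore passes to all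
large n, at any larger rate (`eventually_exp_le_measure_Q2`). Conversely, if overflow has
probability at least exp(-nR) for infinitely many n, then one t, one N and a positive slack achieve
rate R + ε (`exists_exp_le_pathProb_of_frequently`): Fernique bounds truncate and discretize t at
exponentially negligible cost, and a shift of the input together with a small proportion of extra
sources on a steep path turns the discretization error into surplus. The two statements give the
limit; the steep paths make it finite.

The lower bound on J is a Chernoff estimate. The Lagrange multipliers p, q ≥ 0 of the two-constraint
quadratic problem (`exists_multipliers`) bound the path event by exp(-NΥ(s, t)) for every s at once
(`pathProb_le_exp_Ups`), so each rate above J dominates sup_s Υ(s, t) for some t. The same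
multipliers settle the first claim: the minimizer is a combination g of two kernel functions, and
its optimality is the inequality ‖f - g‖² ≥ 0. -/

namespace Tandem

/-! ### Laws and suprema of Gaussian processes -/

section Gaussian

variable {Ω : Type*} [MeasurableSpace Ω] {P : Measure Ω} [IsProbabilityMeasure P]

lemma strongDual_pi_apply {ι : Type*} [Fintype ι] [DecidableEq ι] (L : StrongDual ℝ (ι → ℝ))
    (x : ι → ℝ) : L x = ∑ i, L (Pi.single i 1) * x i := by
  conv_lhs => rw [pi_eq_sum_univ' x]
  simp [map_sum, mul_comm]

/-- Centered Gaussian processes with the same covariance have the same law. -/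
theorem map_eq_of_covariance_eq {T : Type*} {X Y : T → Ω → ℝ}
    (hX : IsGaussianProcess X P) (hY : IsGaussianProcess Y P)
    (mX : AEMeasurable (fun ω t => X t ω) P) (mY : AEMeasurable (fun ω t => Y t ω) P)
    (cX : ∀ t, ∫ ω, X t ω ∂P = 0) (cY : ∀ t, ∫ ω, Y t ω ∂P = 0)
    (h : ∀ s t, cov[X s, X t; P] = cov[Y s, Y t; P]) :
    P.map (fun ω t => X t ω) = P.map (fun ω t => Y t ω) := by
  classical
  rw [map_eq_iff_forall_finset_map_restrict_eq mX mY]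
  intro I
  have key : ∀ {Z : T → Ω → ℝ} (_ : IsGaussianProcess Z P) (_ : ∀ t, ∫ ω, Z t ω ∂P = 0)
      (L : StrongDual ℝ (I → ℝ)),
      charFunDual (P.map (fun ω => I.restrict (Z · ω))) L
        = Complex.exp (-(∑ i, ∑ j, L (Pi.single i 1) * L (Pi.single j 1) *
            cov[Z i, Z j; P] : ℝ) / 2) := by
    intro Z hZ cZ L
    have hL : (fun ω => L (I.restrict (Z · ω)))
        = fun ω => ∑ i : I, L (Pi.single i 1) * Z i ω := by
      ext ω
      rw [strongDual_pi_apply]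
      rfl
    have hmem : ∀ i : I, MemLp (fun ω => L (Pi.single i 1) * Z i ω) 2 P := fun i =>
      (hZ.hasGaussianLaw_eval i).memLp_two.const_mul _
    rw [(hZ.hasGaussianLaw I).charFunDual_map_eq_fun L, hL]
    have h1 : ∫ ω, L (I.restrict (Z · ω)) ∂P = 0 := by
      rw [hL, integral_finsetSum _ fun i _ => (hmem i).integrable (by norm_num)]
      simp [integral_const_mul, cZ]
    have h2 : Var[fun ω => ∑ i : I, L (Pi.single i 1) * Z i ω; P]
        = ∑ i, ∑ j, L (Pi.single i 1) * L (Pi.single j 1) * cov[Z i, Z j; P] := by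
      rw [← covariance_self (memLp_finsetSum _ fun i _ => hmem i).aemeasurable,
        covariance_fun_sum_fun_sum hmem hmem]
      simp_rw [covariance_const_mul_left, covariance_const_mul_right]
      exact Finset.sum_congr rfl fun i _ => Finset.sum_congr rfl fun j _ => by ring
    rw [h2, ← hL, h1]
    simp [neg_div]
  refine Measure.ext_of_charFunDual ?_
  ext L
  rw [key hX cX, key hY cY]
  simp_rw [h]


/-- A Fernique tail bound with universal constants for centered Gaussian sequences. -/
theorem exists_gaussian_sup_tail_bound (P : Measure Ω) [IsProbabilityMeasure P] :
    ∃ κ C : ℝ, 0 < κ ∧ 1 ≤ C ∧ ∀ Z : ℕ → Ω → ℝ,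
      IsGaussianProcess Z P → (∀ i, ∫ ω, Z i ω ∂P = 0) → ∀ a : ℝ, 0 < a →
      P {ω | ∃ i, a < |Z i ω|} ≤ 1 / 4 → ∀ x : ℝ, 0 ≤ x →
      P {ω | ∃ i, x < |Z i ω|} ≤ ENNReal.ofReal (C * Real.exp (-(κ * (x / a) ^ 2))) := by
  -- The ball of radius a has mass at least 3/4, so every constant in Fernique's theorem depends on
  -- 3/4 alone: on neither the process nor the number of coordinates.
  set c : ENNReal := 3 / 4 with hc
  have hc_half : (2 : ENNReal)⁻¹ < c := by
    rw [hc, ← ENNReal.toReal_lt_toReal (by simp) (by finiteness)]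
    norm_num
  have hc_one : c < 1 := by
    rw [hc, ← ENNReal.toReal_lt_toReal (by finiteness) (by simp)]
    norm_num
  have hratio : (c / (1 - c)).toReal = 3 := by
    rw [ENNReal.toReal_div, ENNReal.toReal_sub_of_le hc_one.le (by simp), hc]
    norm_num
  set κ := Fernique.logRatio c with hκ
  have hκpos : 0 < κ := Fernique.logRatio_pos hc_half hc_one
  set C₀ : ENNReal := .ofReal (Real.exp (Fernique.logRatio c))
    + ∑' n : ℕ, .ofReal (Real.exp (-2⁻¹ * Real.log (c / (1 - c)).toReal * 2 ^ n)) with hC₀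
  have hC₀top : C₀ ≠ ⊤ := by
    refine ENNReal.add_ne_top.2 ⟨ENNReal.ofReal_ne_top, ne_of_lt ?_⟩
    refine Summable.tsum_ofReal_lt_top <|
      Real.summable_exp_nat_mul_of_ge ?_ (fun i ↦ mod_cast (Nat.lt_pow_self (by simp)).le)
    rw [hratio]
    exact mul_neg_of_neg_of_pos (by simp) (Real.log_pos (by norm_num))
  have hC₀one : 1 ≤ C₀ := by
    refine le_trans ?_ le_self_add
    rw [← ENNReal.ofReal_one]
    exact ENNReal.ofReal_le_ofReal (Real.one_le_exp hκpos.le)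
  refine ⟨κ, C₀.toReal, hκpos, ?_, fun Z hZ cZ a ha hP x hx => ?_⟩
  · rw [← ENNReal.toReal_one]
    exact ENNReal.toReal_mono hC₀top hC₀one
  -- Finitely many coordinates form a Gaussian vector in the sup norm. The bound is uniform in N and
  -- passes to the whole sequence by continuity from below.
  have hbound : ∀ N : ℕ, P {ω | ∃ i < N, x < |Z i ω|}
      ≤ ENNReal.ofReal (C₀.toReal * Real.exp (-(κ * (x / a) ^ 2))) := by
    intro N
    set μ := P.map (fun ω => (Finset.range N).restrict (Z · ω)) with hμ
    have hG := hZ.hasGaussianLaw (Finset.range N)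
    have hGm : AEMeasurable (fun ω => (Finset.range N).restrict (Z · ω)) P := hG.aemeasurable
    have : IsGaussian μ := hG.isGaussian_map
    have hrot := IsGaussian.map_rotation_eq_self_of_forall_strongDual_eq_zero (μ := μ) (fun L => by
      classical
      rw [hμ, integral_map hGm (by fun_prop)]
      have hL : (fun ω => L ((Finset.range N).restrict (Z · ω)))
          = fun ω => ∑ i : Finset.range N, L (Pi.single i 1) * Z i ω := by
        ext ω
        rw [strongDual_pi_apply]
        rfl
      rw [hL, integral_finsetSum _ fun (i : Finset.range N) _ =>
        ((hZ.hasGaussianLaw_eval (i : ℕ)).integrable.const_mul _)]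
      simp [integral_const_mul, cZ]) (-(Real.pi / 4))
    have hca : c ≤ μ {y | ‖y‖ ≤ a} := by
      rw [hμ, Measure.map_apply_of_aemeasurable hGm (measurableSet_le (by fun_prop) (by fun_prop))]
      have hsub : {ω | ∃ i, a < |Z i ω|}ᶜ ⊆
          (fun ω => (Finset.range N).restrict (Z · ω)) ⁻¹' {y | ‖y‖ ≤ a} := by
        intro ω hω
        simp only [mem_compl_iff, mem_ofPred_eq, not_exists, not_lt] at hω
        simp only [mem_preimage, mem_ofPred_eq]
        exact (pi_norm_le_iff_of_nonneg ha.le).2 fun i => hω i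
      refine le_trans ?_ (measure_mono hsub)
      have h1 : (1 : ENNReal) ≤ 1 / 4 + P {ω | ∃ i, a < |Z i ω|}ᶜ := by
        calc (1 : ENNReal) = P univ := measure_univ.symm
          _ = P ({ω | ∃ i, a < |Z i ω|} ∪ {ω | ∃ i, a < |Z i ω|}ᶜ) := by rw [union_compl_self]
          _ ≤ _ := (measure_union_le _ _).trans (by gcongr)
      have h2 : c = 1 - 1 / 4 := by
        rw [hc, ← ENNReal.toReal_eq_toReal_iff' (by finiteness) (by finiteness),
          ENNReal.toReal_sub_of_le _ (by simp)]
        · norm_num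
        · rw [← ENNReal.toReal_le_toReal (by finiteness) (by simp)]
          norm_num
      rw [h2]
      exact tsub_le_iff_left.2 h1
    have hint := lintegral_exp_mul_sq_norm_le_of_map_rotation_eq_self hrot hca hc_half
    have hexp : 0 < Real.exp (κ * (x / a) ^ 2) := Real.exp_pos _
    have hmark := mul_meas_ge_le_lintegral₀ (μ := μ)
      (f := fun y => ENNReal.ofReal (Real.exp (Fernique.logRatio c * a⁻¹ ^ 2 * ‖y‖ ^ 2)))
      (by fun_prop) (ENNReal.ofReal (Real.exp (κ * (x / a) ^ 2)))
    have hle : P {ω | ∃ i < N, x < |Z i ω|} ≤ μ {y | ENNReal.ofReal (Real.exp (κ * (x / a) ^ 2)) ≤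
        ENNReal.ofReal (Real.exp (Fernique.logRatio c * a⁻¹ ^ 2 * ‖y‖ ^ 2))} := by
      rw [hμ, Measure.map_apply_of_aemeasurable hGm (measurableSet_le (by fun_prop) (by fun_prop))]
      refine measure_mono ?_
      rintro ω ⟨i, hi, hxi⟩
      simp only [mem_preimage, mem_ofPred_eq]
      refine ENNReal.ofReal_le_ofReal (Real.exp_le_exp.2 ?_)
      have h3 : x ≤ ‖(Finset.range N).restrict (Z · ω)‖ :=
        hxi.le.trans (norm_le_pi_norm ((Finset.range N).restrict (Z · ω)) ⟨i, by simpa using hi⟩)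
      rw [div_eq_mul_inv, mul_pow, mul_comm (x ^ 2), ← mul_assoc]
      gcongr
    rw [mul_comm, ENNReal.ofReal_mul (Real.exp_pos _).le, ENNReal.ofReal_toReal hC₀top,
      Real.exp_neg, ENNReal.ofReal_inv_of_pos hexp, mul_comm, ← div_eq_mul_inv,
      ENNReal.le_div_iff_mul_le (by left; simpa using hexp) (by simp)]
    calc _ ≤ _ := mul_le_mul_left hle _
      _ ≤ _ := by rw [mul_comm]; exact hmark
      _ ≤ _ := hint
  have hU : {ω | ∃ i, x < |Z i ω|} = ⋃ N : ℕ, {ω | ∃ i < N, x < |Z i ω|} := by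
    ext ω
    simp only [mem_ofPred_eq, mem_iUnion]
    exact ⟨fun ⟨i, hi⟩ => ⟨i + 1, i, by omega, hi⟩, fun ⟨_, i, _, hi⟩ => ⟨i, hi⟩⟩
  rw [hU, Monotone.measure_iUnion]
  · exact iSup_le hbound
  · rintro N M hNM ω ⟨i, hi, hxi⟩
    exact ⟨i, hi.trans_le hNM, hxi⟩

end Gaussian

end Tandem

namespace Tandem

/-! ### Superpositions, scalings and shifts of sources -/

section Sources

variable {Ω : Type*} [MeasurableSpace Ω]

/-- A centered Gaussian process with continuous paths, started at zero, whose covariance is `k`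
times the covariance `Gam v` of a source. -/
structure IsScaledSource (P : Measure Ω) (v : ℝ → ℝ) (k : ℝ) (X : ℝ → Ω → ℝ) : Prop where
  gaussian : IsGaussianProcess X P
  centered : ∀ t, ∫ ω, X t ω ∂P = 0
  start_zero : ∀ ω, X 0 ω = 0
  continuous_paths : ∀ ω, Continuous fun t => X t ω
  aemeasurable : AEMeasurable (fun ω t => X t ω) P
  covariance_eq : ∀ s t, cov[X s, X t; P] = k * Gam v s t

variable {P : Measure Ω} {v : ℝ → ℝ} {k l : ℝ} {X Y : ℝ → Ω → ℝ}

lemma IsGaussianSource.v_zero (h : IsGaussianSource P v X) : v 0 = 0 := by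
  have := h.variance_eq 0 0 le_rfl
  simp only [sub_self] at this
  rw [← this]
  exact variance_zero P

lemma IsGaussianSource.isScaledSource (h : IsGaussianSource P v X)
    (hm : AEMeasurable (fun ω t => X t ω) P) : IsScaledSource P v 1 X where
  gaussian := h.gaussian
  centered := h.centered
  start_zero := h.start_zero
  continuous_paths := h.continuous_paths
  aemeasurable := hm
  covariance_eq s t := by
    have hprob := h.gaussian.isProbabilityMeasure
    have hL := fun t => (h.gaussian.hasGaussianLaw_eval t).memLp_two
    have hinc : ∀ s t, Var[fun ω => X t ω - X s ω; P] = v |t - s| := by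
      intro s t
      rcases le_total s t with hst | hst
      · rw [h.variance_eq s t hst, abs_of_nonneg (by linarith)]
      · have h1 : (fun ω => X t ω - X s ω) = -(fun ω => X s ω - X t ω) := by
          ext ω
          simp
        rw [h1, variance_neg, h.variance_eq t s hst, abs_of_nonpos (by linarith)]
        congr 1
        ring
    have hvar : ∀ t, Var[X t; P] = v |t| := by
      intro t
      have := hinc 0 t
      simpa [h.start_zero] using this
    have h2 := hinc s t
    rw [variance_fun_sub (hL t) (hL s), hvar, hvar, covariance_comm] at h2
    rw [Gam, ← h2]
    ring

namespace IsScaledSource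

lemma memLp (hX : IsScaledSource P v k X) (t : ℝ) : MemLp (X t) 2 P :=
  (hX.gaussian.hasGaussianLaw_eval t).memLp_two

/-- With factor √n this turns one source into a process with the law of a sum of n sources. -/
lemma const_mul (hX : IsScaledSource P v k X) (c : ℝ) :
    IsScaledSource P v (c ^ 2 * k) (fun t ω => c * X t ω) where
  gaussian := hX.gaussian.smul fun _ => c
  centered t := by rw [integral_const_mul, hX.centered, mul_zero]
  start_zero ω := by simp [hX.start_zero]
  continuous_paths ω := by
    have := hX.continuous_paths ω
    fun_prop
  aemeasurable := by
    have hm : Measurable (fun (x : ℝ → ℝ) (t : ℝ) => c * x t) :=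
      measurable_pi_lambda _ fun t => (measurable_pi_apply _).const_mul _
    exact hm.comp_aemeasurable hX.aemeasurable
  covariance_eq s t := by
    rw [covariance_const_mul_left, covariance_const_mul_right, hX.covariance_eq]
    ring

lemma variance_eq (hX : IsScaledSource P v k X) (hv0 : v 0 = 0) (t : ℝ) :
    Var[X t; P] = k * v |t| := by
  rw [← covariance_self (hX.memLp t).aemeasurable, hX.covariance_eq, Gam]
  simp [hv0]

variable [IsProbabilityMeasure P]

/-- Stationarity of increments is already encoded in `Gam`: the terms that depend on h cancel. -/
lemma shift (hX : IsScaledSource P v k X) (hv0 : v 0 = 0) (h : ℝ) :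
    IsScaledSource P v k (fun t ω => X (h + t) ω - X h ω) where
  gaussian := hX.gaussian.shift h
  centered t := by
    rw [integral_sub ((hX.memLp _).integrable (by norm_num)) ((hX.memLp _).integrable (by norm_num)),
      hX.centered, hX.centered, sub_zero]
  start_zero ω := by simp
  continuous_paths ω := by
    have := hX.continuous_paths ω
    fun_prop
  aemeasurable := by
    have hm : Measurable (fun (x : ℝ → ℝ) (t : ℝ) => x (h + t) - x h) :=
      measurable_pi_lambda _ fun t => (measurable_pi_apply _).sub (measurable_pi_apply _)
    exact hm.comp_aemeasurable hX.aemeasurable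
  covariance_eq s t := by
    rw [covariance_fun_sub_fun_sub (hX.memLp _) (hX.memLp _) (hX.memLp _) (hX.memLp _)]
    simp only [hX.covariance_eq, Gam]
    simp only [sub_self, abs_zero, hv0, add_sub_add_left_eq_sub, sub_add_cancel_left, abs_neg,
      add_sub_cancel_left]
    ring

lemma add (hX : IsScaledSource P v k X) (hY : IsScaledSource P v l Y)
    (hXY : IndepFun (fun ω t => X t ω) (fun ω t => Y t ω) P) :
    IsScaledSource P v (k + l) (fun t ω => X t ω + Y t ω) where
  gaussian := ⟨fun I => by
    have hm := Finset.measurable_restrict (X := fun _ : ℝ => ℝ) I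
    have h := IndepFun.hasGaussianLaw (hX.gaussian.hasGaussianLaw I)
      (hY.gaussian.hasGaussianLaw I) (hXY.comp hm hm)
    exact h.fun_add⟩
  centered t := by
    rw [integral_add ((hX.memLp _).integrable (by norm_num)) ((hY.memLp _).integrable (by norm_num)),
      hX.centered, hY.centered, add_zero]
  start_zero ω := by simp [hX.start_zero, hY.start_zero]
  continuous_paths ω := by
    have := hX.continuous_paths ω
    have := hY.continuous_paths ω
    fun_prop
  aemeasurable := by
    have hm : Measurable (fun (x : (ℝ → ℝ) × (ℝ → ℝ)) (t : ℝ) => x.1 t + x.2 t) :=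
      measurable_pi_lambda _ fun t => by fun_prop
    exact hm.comp_aemeasurable (hX.aemeasurable.prodMk hY.aemeasurable)
  covariance_eq s t := by
    have hind : ∀ s t, cov[X s, Y t; P] = 0 := fun s t =>
      (hXY.comp (measurable_pi_apply s) (measurable_pi_apply t)).covariance_eq_zero
        (hX.memLp s) (hY.memLp t)
    change cov[X s + Y s, X t + Y t; P] = _
    rw [covariance_add_left (hX.memLp _) (hY.memLp _) ((hX.memLp _).add (hY.memLp _)),
      covariance_add_right (hX.memLp _) (hX.memLp _) (hY.memLp _),
      covariance_add_right (hY.memLp _) (hX.memLp _) (hY.memLp _),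
      hind, covariance_comm (Y s), hind, hX.covariance_eq, hY.covariance_eq]
    ring

/-- The law of a scaled source depends on the scale only. -/
lemma measure_eq (hX : IsScaledSource P v k X) (hY : IsScaledSource P v k Y) {S : Set (ℝ → ℝ)}
    (hS : MeasurableSet S) : P {ω | (fun t => X t ω) ∈ S} = P {ω | (fun t => Y t ω) ∈ S} := by
  have h := map_eq_of_covariance_eq hX.gaussian hY.gaussian hX.aemeasurable hY.aemeasurable
    hX.centered hY.centered fun s t => by rw [hX.covariance_eq, hY.covariance_eq]
  have h1 := congrArg (fun μ => μ S) h
  rw [Measure.map_apply_of_aemeasurable hX.aemeasurable hS,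
    Measure.map_apply_of_aemeasurable hY.aemeasurable hS] at h1
  exact h1

end IsScaledSource

namespace IsIIDGaussianSources

variable {A : ℕ → ℝ → Ω → ℝ}

lemma aemeasurable (hA : IsIIDGaussianSources P v A) (i : ℕ) :
    AEMeasurable (fun ω t => A i t ω) P :=
  (hA.identDistrib i i).aemeasurable_fst

lemma indepFun_sum (hA : IsIIDGaussianSources P v A) {S T : Finset ℕ} (hST : Disjoint S T) :
    IndepFun (fun ω t => ∑ i ∈ S, A i t ω) (fun ω t => ∑ i ∈ T, A i t ω) P := by
  have h := hA.indep.indepFun_finset₀ S T hST hA.aemeasurable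
  have hm : ∀ U : Finset ℕ, Measurable (fun (x : U → ℝ → ℝ) (t : ℝ) => ∑ i : U, x i t) :=
    fun U => measurable_pi_lambda _ fun t => by fun_prop
  have h2 := h.comp (hm S) (hm T)
  have he : ∀ U : Finset ℕ, (fun ω (t : ℝ) => ∑ i ∈ U, A i t ω)
      = (fun (x : U → ℝ → ℝ) (t : ℝ) => ∑ i : U, x i t) ∘ fun ω (i : U) t => A i t ω := by
    intro U
    ext ω t
    simp only [Function.comp]
    rw [← Finset.sum_coe_sort]
  rw [he S, he T]
  exact h2

lemma isScaledSource_sum [IsProbabilityMeasure P] (hA : IsIIDGaussianSources P v A) (S : Finset ℕ) :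
    IsScaledSource P v S.card (fun t ω => ∑ i ∈ S, A i t ω) := by
  classical
  induction S using Finset.induction with
  | empty =>
    -- The empty sum is 0 times a source.
    have h := (((hA.source 0).isScaledSource (hA.aemeasurable 0)).const_mul 0)
    simpa using h
  | insert i S hi ih =>
    have h1 := (hA.source i).isScaledSource (hA.aemeasurable i)
    have hind := hA.indepFun_sum (S := {i}) (T := S) (by simpa using hi)
    simp only [Finset.sum_singleton] at hind
    have h2 := h1.add ih hind
    simp only [Finset.sum_insert hi, Finset.card_insert_of_notMem hi]
    convert h2 using 1
    push_cast
    ring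

end IsIIDGaussianSources

/-- The variance function of a source is continuous. -/
lemma IsScaledSource.continuous_variance [IsProbabilityMeasure P] (hX : IsScaledSource P v 1 X)
    (hv0 : v 0 = 0) : Continuous fun t : ℝ => v |t| := by
  -- The characteristic function at 1 has a bounded integrand, so path continuity and dominated
  -- convergence make it continuous in t; its logarithm recovers v.
  have h1 : ∀ t, ∫ ω, Complex.exp (X t ω * Complex.I) ∂P = Complex.exp ((-(v |t| / 2) : ℝ)) := by
    intro t
    have h2 := charFun_gaussianReal (μ := 0) (v := (Var[X t; P]).toNNReal) 1
    have h3 := (hX.gaussian.hasGaussianLaw_eval t).map_eq_gaussianReal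
    rw [hX.centered] at h3
    rw [← h3, charFun_apply_real, integral_map (hX.memLp t).aemeasurable (by fun_prop)] at h2
    rw [show (fun ω => Complex.exp (X t ω * Complex.I))
      = fun ω => Complex.exp ((1 : ℝ) * (X t ω : ℂ) * Complex.I) by simp, h2]
    congr 1
    have h5 : ((Var[X t; P]).toNNReal : ℝ) = v |t| := by
      rw [Real.coe_toNNReal _ (variance_nonneg _ _), hX.variance_eq hv0, one_mul]
    rw [← h5]
    push_cast
    simp
  have h2 : ∀ t, v |t| = -2 * Real.log ‖∫ ω, Complex.exp (X t ω * Complex.I) ∂P‖ := by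
    intro t
    rw [h1, Complex.norm_exp_ofReal, Real.log_exp]
    ring
  have hc : Continuous fun t => ∫ ω, Complex.exp (X t ω * Complex.I) ∂P := by
    refine continuous_of_dominated (bound := fun _ => 1) (fun t => ?_) (fun t => ?_)
      (integrable_const _) ?_
    · have := (hX.memLp t).aestronglyMeasurable
      fun_prop
    · exact .of_forall fun ω => by rw [Complex.norm_exp_ofReal_mul_I]
    · refine .of_forall fun ω => ?_
      have := hX.continuous_paths ω
      fun_prop
  simp_rw [h2]
  refine continuous_const.mul (hc.norm.log fun t => ?_)
  rw [h1]
  simp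

end Sources

end Tandem

namespace Tandem

/-! ### Consequences of concavity of √v, and the quadratic problem -/

section Variance

variable {v : ℝ → ℝ}

namespace RegularVariance

lemma sqrt_pos (hv : RegularVariance v) {t : ℝ} (ht : 0 < t) : 0 < √(v t) :=
  (Real.sqrt_nonneg (v 0)).trans_lt (hv.strictMonoOn (mem_Ici.2 le_rfl) (mem_Ici.2 ht.le) ht)

lemma pos (hv : RegularVariance v) {t : ℝ} (ht : 0 < t) : 0 < v t :=
  Real.sqrt_pos.1 (hv.sqrt_pos ht)

lemma nonneg (hv : RegularVariance v) (hv0 : v 0 = 0) {t : ℝ} (ht : 0 ≤ t) : 0 ≤ v t := by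
  rcases ht.eq_or_lt with rfl | ht
  · exact hv0.ge
  · exact (hv.pos ht).le

lemma sq_sqrt (hv : RegularVariance v) (hv0 : v 0 = 0) {t : ℝ} (ht : 0 ≤ t) : √(v t) ^ 2 = v t :=
  Real.sq_sqrt (hv.nonneg hv0 ht)

lemma lt_of_lt (hv : RegularVariance v) {s t : ℝ} (hs : 0 ≤ s) (hst : s < t) : v s < v t :=
  (Real.sqrt_lt_sqrt_iff_of_pos (hv.pos (hs.trans_lt hst))).1
    (hv.strictMonoOn (mem_Ici.2 hs) (mem_Ici.2 (hs.trans hst.le)) hst)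

lemma le_of_le (hv : RegularVariance v) {s t : ℝ} (hs : 0 ≤ s) (hst : s ≤ t) : v s ≤ v t := by
  rcases hst.eq_or_lt with rfl | hst
  · exact le_rfl
  · exact (hv.lt_of_lt hs hst).le

/-- `√v(t) / t` is strictly decreasing. -/
lemma mul_sqrt_lt (hv : RegularVariance v) (hv0 : v 0 = 0) {u t : ℝ} (hu : 0 < u) (hut : u < t) :
    u * √(v t) < t * √(v u) := by
  have ht := hu.trans hut
  have hcc := hv.strictConcaveOn.2
  have h := hcc (mem_Ici.2 le_rfl) (mem_Ici.2 ht.le) ht.ne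
    (a := 1 - u / t) (b := u / t) (by rw [sub_pos, div_lt_one ht]; exact hut) (by positivity)
    (by ring)
  simp only [smul_eq_mul, mul_zero, hv0, Real.sqrt_zero, zero_add] at h
  rw [div_mul_cancel₀ _ ht.ne', div_mul_eq_mul_div, div_lt_iff₀ ht] at h
  linarith

/-- `√v` is strictly subadditive. -/
lemma sqrt_add_lt (hv : RegularVariance v) (hv0 : v 0 = 0) {u w : ℝ} (hu : 0 < u) (hw : 0 < w) :
    √(v (u + w)) < √(v u) + √(v w) := by
  have h1 := hv.mul_sqrt_lt hv0 hu (show u < u + w by linarith)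
  have h2 := hv.mul_sqrt_lt hv0 hw (show w < u + w by linarith)
  have h3 : (u + w) * √(v (u + w)) < (u + w) * (√(v u) + √(v w)) := by linarith
  exact lt_of_mul_lt_mul_left h3 (by linarith)

/-- On bounded intervals `√v` grows at least linearly. -/
lemma exists_mul_sub_le (hv : RegularVariance v) (T : ℝ) :
    ∃ c : ℝ, 0 < c ∧ ∀ s t : ℝ, 0 ≤ s → s ≤ t → t ≤ T → c * (t - s) ≤ √(v t) - √(v s) := by
  by_cases hT : 0 ≤ T
  swap
  · exact ⟨1, one_pos, fun s t hs hst ht => absurd (hs.trans (hst.trans ht)) hT⟩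
  -- The slope over [T, T + 1], which by concavity is below every slope further left.
  refine ⟨√(v (T + 1)) - √(v T), ?_, fun s t hs hst ht => ?_⟩
  · exact sub_pos.2 (hv.strictMonoOn (mem_Ici.2 hT) (mem_Ici.2 (by linarith)) (by linarith))
  rcases hst.eq_or_lt with rfl | hst
  · simp
  have hc := hv.strictConcaveOn.concaveOn
  have h1 := hc.slope_anti_adjacent (mem_Ici.2 hs) (mem_Ici.2 (show 0 ≤ T + 1 by linarith)) hst
    (show t < T + 1 by linarith)
  have h2 : (√(v (T + 1)) - √(v T)) ≤ (√(v (T + 1)) - √(v t)) / (T + 1 - t) := by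
    rcases ht.eq_or_lt with rfl | ht
    · simp
    have h3 := hc.slope_anti_adjacent (mem_Ici.2 (hs.trans hst.le))
      (mem_Ici.2 (show 0 ≤ T + 1 by linarith)) ht (show T < T + 1 by linarith)
    rw [add_sub_cancel_left, div_one, le_div_iff₀ (by linarith)] at h3
    rw [le_div_iff₀ (by linarith)]
    linarith
  have h4 := h2.trans h1
  rwa [le_div_iff₀ (by linarith)] at h4

end RegularVariance

lemma Gam_comm (v : ℝ → ℝ) (s t : ℝ) : Gam v s t = Gam v t s := by
  rw [Gam, Gam, abs_sub_comm]
  ring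

lemma Gam_self (hv0 : v 0 = 0) (t : ℝ) : Gam v t t = v |t| := by
  simp [Gam, hv0]

lemma Gam_neg_neg (v : ℝ → ℝ) (s t : ℝ) : Gam v (-s) (-t) = Gam v s t := by
  rw [Gam, Gam, abs_neg, abs_neg, neg_sub_neg, abs_sub_comm]

lemma Gam_of_le {s t : ℝ} (hs : 0 ≤ s) (hst : s ≤ t) :
    Gam v s t = (v t - v (t - s) + v s) / 2 := by
  rw [Gam, abs_of_nonneg (hs.trans hst), abs_of_nonneg hs, abs_of_nonneg (by linarith)]

namespace RegularVariance

lemma Gam_pos (hv : RegularVariance v) {u t : ℝ} (hu : 0 < u) (hut : u < t) : 0 < Gam v u t := by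
  rw [Gam_of_le hu.le hut.le]
  have h1 := hv.lt_of_lt (show 0 ≤ t - u by linarith) (show t - u < t by linarith)
  have h2 := hv.pos hu
  linarith

/-- Strict subadditivity gives v(t - u) > (√v(t) - √v(u))², which is a strict Cauchy–Schwarz
inequality. It makes the covariance matrix invertible. -/
lemma Gam_lt (hv : RegularVariance v) (hv0 : v 0 = 0) {u t : ℝ} (hu : 0 < u) (hut : u < t) :
    Gam v u t < √(v u) * √(v t) := by
  rw [Gam_of_le hu.le hut.le]
  have h1 := hv.sqrt_add_lt hv0 hu (show 0 < t - u by linarith)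
  rw [add_sub_cancel] at h1
  have h2 := hv.strictMonoOn (mem_Ici.2 hu.le) (mem_Ici.2 (hu.trans hut).le) hut
  simp only at h2
  have h3 := hv.sq_sqrt hv0 hu.le
  have h4 := hv.sq_sqrt hv0 (hu.trans hut).le
  have h5 := hv.sq_sqrt hv0 (show 0 ≤ t - u by linarith)
  nlinarith [Real.sqrt_nonneg (v (t - u))]

lemma Gam_sq_lt (hv : RegularVariance v) (hv0 : v 0 = 0) {u t : ℝ} (hu : 0 < u) (hut : u < t) :
    Gam v u t ^ 2 < v t * v u := by
  have h1 := hv.Gam_lt hv0 hu hut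
  have h2 := pow_lt_pow_left₀ h1 (hv.Gam_pos hu hut).le two_ne_zero
  rwa [mul_pow, hv.sq_sqrt hv0 hu.le, hv.sq_sqrt hv0 (hu.trans hut).le, mul_comm] at h2

/-- The Lagrange multipliers of the quadratic minimization problem with value `Ups`. -/
theorem exists_multipliers (hv : RegularVariance v) (hv0 : v 0 = 0) {b c₁ c₂ s t : ℝ}
    (hb : 0 < b) (hc₂ : 0 < c₂) (hc : c₂ < c₁) (ht : b / (c₁ - c₂) < t) (hs : s ∈ Ioo 0 t) :
    ∃ p q : ℝ, 0 ≤ p ∧ 0 ≤ q ∧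
      b + c₂ * t ≤ v t * p + Gam v (t - s) t * q ∧
      b + c₂ * t - c₁ * s ≤ Gam v (t - s) t * p + v (t - s) * q ∧
      p * (b + c₂ * t) + q * (b + c₂ * t - c₁ * s) = 2 * Ups v b c₁ c₂ s t ∧
      v t * p ^ 2 + 2 * Gam v (t - s) t * p * q + v (t - s) * q ^ 2 = 2 * Ups v b c₁ c₂ s t := by
  obtain ⟨hs0, hst⟩ := hs
  have ht0 : 0 < t := hs0.trans hst
  have hu : 0 < t - s := by linarith
  have hut : t - s < t := by linarith
  have hV := hv.pos ht0
  have hW := hv.pos hu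
  have hG := hv.Gam_pos hu hut
  have hD : 0 < v t * v (t - s) - Gam v (t - s) t ^ 2 := sub_pos.2 (hv.Gam_sq_lt hv0 hu hut)
  have hsum : Gam v s t = v t - Gam v (t - s) t := by
    rw [Gam_of_le hs0.le hst.le, Gam_of_le hu.le hut.le, sub_sub_cancel]
    ring
  have hbt : b + c₂ * t < c₁ * t := by
    rw [div_lt_iff₀ (by linarith)] at ht
    linarith
  have hy : 0 < b + c₂ * t := by positivity
  -- Strict Cauchy–Schwarz combined with the decrease of √v(x)/x. This is what makes p positive when
  -- both constraints are active.
  have hgr : (t - s) * Gam v (t - s) t < t * v (t - s) := by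
    have h1 := hv.Gam_lt hv0 hu hut
    have h2 := hv.mul_sqrt_lt hv0 hu hut
    have h3 := hv.sqrt_pos hu
    calc (t - s) * Gam v (t - s) t < (t - s) * (√(v (t - s)) * √(v t)) := by gcongr
      _ = √(v (t - s)) * ((t - s) * √(v t)) := by ring
      _ < √(v (t - s)) * (t * √(v (t - s))) := by gcongr
      _ = t * √(v (t - s)) ^ 2 := by ring
      _ = _ := by rw [hv.sq_sqrt hv0 hu.le]
  set V := v t
  set W := v (t - s)
  set G := Gam v (t - s) t with hGdef
  set y := b + c₂ * t with hydef
  by_cases hk : c₁ * s < kfun v b c₂ s t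
  -- Both constraints are active: (p, q) solves the 2×2 linear system. This is the numerator of q,
  -- and its sign is exactly the condition k(s, t) > c₁s.
  · have hz : 0 < V * (y - c₁ * s) - G * y := by
      rw [kfun, hsum, ← hydef, div_mul_eq_mul_div, lt_div_iff₀ hV] at hk
      linarith
    have hzpos : 0 < y - c₁ * s := by
      by_contra h
      have h1 : 0 < G * y := by positivity
      nlinarith
    have hp : 0 < W * y - G * (y - c₁ * s) := by
      have h1 : t * (y - c₁ * s) < (t - s) * y := by nlinarith
      have h2 : t * (G * (y - c₁ * s)) < t * (W * y) := by nlinarith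
      linarith [lt_of_mul_lt_mul_left h2 ht0.le]
    have hUps : 2 * Ups v b c₁ c₂ s t = (W * y ^ 2 - 2 * G * y * (y - c₁ * s)
        + V * (y - c₁ * s) ^ 2) / (V * W - G ^ 2) := by
      rw [Ups, if_pos hk, Lam, covMat, Matrix.inv_def, Matrix.adjugate_fin_two_of,
        Matrix.det_fin_two_of]
      simp only [Matrix.smul_mulVec, Matrix.cons_mulVec, Matrix.cons_dotProduct,
        Ring.inverse_eq_inv', dotProduct_smul, smul_eq_mul]
      simp
      field_simp
      ring
    have hD' := hD.ne'
    refine ⟨(W * y - G * (y - c₁ * s)) / (V * W - G ^ 2), (V * (y - c₁ * s) - G * y) /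
      (V * W - G ^ 2), by positivity, by positivity, le_of_eq ?_, le_of_eq ?_, ?_, ?_⟩
    · rw [← mul_div_assoc, ← mul_div_assoc, ← add_div, eq_div_iff hD']
      ring
    · rw [← mul_div_assoc, ← mul_div_assoc, ← add_div, eq_div_iff hD']
      ring
    · rw [hUps]
      field_simp
      ring
    · rw [hUps]
      field_simp
      ring
  · have hUps : 2 * Ups v b c₁ c₂ s t = y ^ 2 / V := by
      rw [Ups, if_neg hk, ← hydef, mul_div_assoc', mul_div_mul_left _ _ two_ne_zero]
    have hk' : V * (y - c₁ * s) ≤ G * y := by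
      rw [not_lt, kfun, hsum, ← hydef, div_mul_eq_mul_div, div_le_iff₀ hV] at hk
      linarith
    -- Only the first constraint is active; its minimizer meets the second because k(s, t) ≤ c₁s.
    refine ⟨y / V, 0, by positivity, le_rfl, ?_, ?_, ?_, ?_⟩
    · simp only [mul_zero, add_zero]
      rw [mul_div_cancel₀ _ hV.ne']
    · rw [mul_zero, add_zero, ← mul_div_assoc, le_div_iff₀ hV]
      linarith
    · rw [hUps]
      field_simp
      ring
    · rw [hUps]
      field_simp
      ring

end RegularVariance

end Variance

end Tandem

namespace Tandem

/-! ### Subquadratic growth -/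

section Growth

variable {v : ℝ → ℝ}

/-- The given exponent may be negative; raising it to at least 1 puts 2 - β in (0, 1], as the tail
sums require. -/
lemma SubquadraticGrowth.exists_eventually_le_rpow (h : SubquadraticGrowth v) :
    ∃ β : ℝ, 1 ≤ β ∧ β < 2 ∧ ∀ᶠ t : ℝ in atTop, v t ≤ t ^ β := by
  obtain ⟨α, hα, hlim⟩ := h
  refine ⟨max α 1, le_max_right _ _, max_lt hα one_lt_two, ?_⟩
  filter_upwards [hlim.eventually (gt_mem_nhds one_pos), eventually_ge_atTop 1] with t h1 ht
  have hpos : 0 < t ^ α := Real.rpow_pos_of_pos (by linarith) _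
  rw [div_lt_one hpos] at h1
  exact h1.le.trans (Real.rpow_le_rpow_of_exponent_le ht (le_max_left _ _))

lemma SubquadraticGrowth.tendsto_sqrt_div (h : SubquadraticGrowth v) :
    Tendsto (fun t => √(v t) / (1 + t)) atTop (𝓝 0) := by
  obtain ⟨β, hβ1, hβ2, hle⟩ := h.exists_eventually_le_rpow
  have hlim : Tendsto (fun t : ℝ => t ^ (-(1 - β / 2))) atTop (𝓝 0) :=
    tendsto_rpow_neg_atTop (by linarith)
  refine squeeze_zero' ?_ ?_ hlim
  · filter_upwards [eventually_ge_atTop 0] with t ht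
    positivity
  · filter_upwards [hle, eventually_gt_atTop 0] with t h1 ht
    have h2 : √(v t) ≤ t ^ (β / 2) := by
      rw [Real.sqrt_le_left (Real.rpow_nonneg ht.le _), ← Real.rpow_natCast, ← Real.rpow_mul ht.le]
      simpa using h1
    rw [div_le_iff₀ (by linarith)]
    have h3 : t ^ (β / 2) = t ^ (-(1 - β / 2)) * t := by
      nth_rewrite 3 [← Real.rpow_one t]
      rw [← Real.rpow_add ht]
      congr 1
      ring
    have h4 : 0 < t ^ (-(1 - β / 2)) := Real.rpow_pos_of_pos ht _
    nlinarith

end Growth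

/-! ### The reproducing kernel Hilbert space and the first claim -/

section RKHS

variable {Ω : Type*} [MeasurableSpace Ω] {P : Measure Ω} [IsProbabilityMeasure P]
  {v : ℝ → ℝ} {X : ℝ → Ω → ℝ}

/-- The bilinear form `⟨∑ c(s) Γ(s, ·), ∑ d(r) Γ(r, ·)⟩ = ∑ ∑ c(s) d(r) Γ(s, r)`. -/
noncomputable def gramForm (v : ℝ → ℝ) : (ℝ →₀ ℝ) →ₗ[ℝ] (ℝ →₀ ℝ) →ₗ[ℝ] ℝ :=
  Finsupp.linearCombination ℝ fun s => Finsupp.linearCombination ℝ fun r => Gam v s r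

lemma gramForm_apply (v : ℝ → ℝ) (c d : ℝ →₀ ℝ) :
    gramForm v c d = c.sum fun s a => d.sum fun r a' => a * a' * Gam v s r := by
  rw [gramForm, Finsupp.linearCombination_apply]
  simp only [Finsupp.sum, LinearMap.sum_apply]
  refine Finset.sum_congr rfl fun s _ => ?_
  rw [LinearMap.smul_apply, Finsupp.linearCombination_apply]
  simp only [Finsupp.sum, Finset.smul_sum]
  exact Finset.sum_congr rfl fun r _ => by simp only [smul_eq_mul]; ring

lemma gramForm_single (v : ℝ → ℝ) (s t : ℝ) :
    gramForm v (Finsupp.single s 1) (Finsupp.single t 1) = Gam v s t := by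
  simp [gramForm]

lemma gramForm_comm (v : ℝ → ℝ) (c d : ℝ →₀ ℝ) : gramForm v c d = gramForm v d c := by
  rw [gramForm_apply, gramForm_apply, Finsupp.sum, Finsupp.sum]
  simp only [Finsupp.sum]
  rw [Finset.sum_comm]
  refine Finset.sum_congr rfl fun r _ => Finset.sum_congr rfl fun s _ => ?_
  rw [Gam_comm]
  ring

lemma kernelComb_eq_gramForm (v : ℝ → ℝ) (c : ℝ →₀ ℝ) (t : ℝ) :
    kernelComb v c t = gramForm v c (Finsupp.single t 1) := by
  rw [kernelComb, gramForm_apply]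
  simp

/-- The form is the variance of ∑ c(s) X(s): positivity of the kernel comes from the existence of
the process. -/
lemma IsScaledSource.gramForm_self_nonneg (hX : IsScaledSource P v 1 X) (c : ℝ →₀ ℝ) :
    0 ≤ gramForm v c c := by
  have hmem : ∀ s ∈ c.support, MemLp (fun ω => c s * X s ω) 2 P := fun s _ =>
    (hX.memLp s).const_mul _
  have h : gramForm v c c = Var[fun ω => ∑ s ∈ c.support, c s * X s ω; P] := by
    rw [← covariance_self (memLp_finsetSum _ hmem).aemeasurable,
      covariance_fun_sum_left' hmem (memLp_finsetSum _ hmem), gramForm_apply]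
    refine Finset.sum_congr rfl fun s hs => ?_
    rw [covariance_fun_sum_right' hmem (hmem s hs)]
    refine Finset.sum_congr rfl fun r hr => ?_
    rw [covariance_const_mul_left, covariance_const_mul_right, hX.covariance_eq]
    ring
  rw [h]
  exact variance_nonneg _ _

lemma IsScaledSource.gramForm_sq_le (hX : IsScaledSource P v 1 X) (c d : ℝ →₀ ℝ) :
    gramForm v c d ^ 2 ≤ gramForm v c c * gramForm v d d := by
  have h : ∀ x : ℝ, 0 ≤ gramForm v c c * (x * x) + 2 * gramForm v c d * x + gramForm v d d := by
    intro x
    have h1 := hX.gramForm_self_nonneg (x • c + d)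
    simp only [map_add, map_smul, LinearMap.add_apply, LinearMap.smul_apply, smul_eq_mul,
      gramForm_comm v d c] at h1
    linarith
  have h2 := discrim_le_zero h
  rw [discrim] at h2
  nlinarith

lemma kernelCombNorm_eq (v : ℝ → ℝ) (c : ℝ →₀ ℝ) : kernelCombNorm v c = √(gramForm v c c) := by
  rw [kernelCombNorm, gramForm_apply]

lemma kernelCombNorm_nonneg (v : ℝ → ℝ) (c : ℝ →₀ ℝ) : 0 ≤ kernelCombNorm v c :=
  Real.sqrt_nonneg _

lemma IsScaledSource.kernelCombNorm_sq (hX : IsScaledSource P v 1 X) (c : ℝ →₀ ℝ) :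
    kernelCombNorm v c ^ 2 = gramForm v c c := by
  rw [kernelCombNorm_eq, Real.sq_sqrt (hX.gramForm_self_nonneg c)]

lemma IsScaledSource.kernelCombNorm_le_add (hX : IsScaledSource P v 1 X) (c d : ℝ →₀ ℝ) :
    kernelCombNorm v c ≤ kernelCombNorm v (c - d) + kernelCombNorm v d := by
  have h0 := kernelCombNorm_nonneg v (c - d)
  have h1 := kernelCombNorm_nonneg v d
  refine le_of_sq_le_sq ?_ (by positivity)
  have h2 := hX.gramForm_sq_le (c - d) d
  rw [← hX.kernelCombNorm_sq, ← hX.kernelCombNorm_sq, ← mul_pow] at h2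
  have h3 := (abs_le.1 (abs_le_of_sq_le_sq h2 (by positivity))).2
  have h4 : gramForm v c c = gramForm v (c - d) (c - d) + 2 * gramForm v (c - d) d
      + gramForm v d d := by
    simp only [map_sub, LinearMap.sub_apply, gramForm_comm v d c]
    ring
  rw [hX.kernelCombNorm_sq, h4, ← hX.kernelCombNorm_sq, ← hX.kernelCombNorm_sq]
  nlinarith

/-- Ensures that the `sInf` in `rkhsNorm` is over a nonempty set and not the default value 0. -/
lemma IsScaledSource.exists_tendsto_kernelCombNorm (hX : IsScaledSource P v 1 X)
    {c : ℕ → ℝ →₀ ℝ} {f : ℝ → ℝ} (h : IsKernelLimit v c f) :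
    ∃ x, Tendsto (fun n => kernelCombNorm v (c n)) atTop (𝓝 x) := by
  refine cauchySeq_tendsto_of_complete (Metric.cauchySeq_iff.2 fun ε hε => ?_)
  obtain ⟨N, hN⟩ := h.cauchy ε hε
  refine ⟨N, fun m hm n hn => ?_⟩
  rw [Real.dist_eq, abs_lt]
  have h1 := hX.kernelCombNorm_le_add (c m) (c n)
  have h2 := hX.kernelCombNorm_le_add (c n) (c m)
  have h3 := hN m hm n hn
  have h4 := hN n hn m hm
  constructor <;> linarith

lemma IsScaledSource.abs_Gam_le (hX : IsScaledSource P v 1 X) (hv0 : v 0 = 0) (s t : ℝ) :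
    |Gam v s t| ≤ √(v |s|) * √(v |t|) := by
  have h := hX.gramForm_sq_le (Finsupp.single s 1) (Finsupp.single t 1)
  have hs := hX.gramForm_self_nonneg (Finsupp.single s 1)
  rw [gramForm_single, gramForm_single, Gam_self hv0] at *
  rw [gramForm_single, Gam_self hv0] at h
  rw [← Real.sqrt_mul hs]
  exact Real.abs_le_sqrt h

/-- Cauchy–Schwarz bounds Γ(s, t) by a multiple of √v(|t|), which is sublinear. -/
lemma IsScaledSource.Gam_mem_pathSpace (hX : IsScaledSource P v 1 X) (hv0 : v 0 = 0)
    (hg : SubquadraticGrowth v) (s : ℝ) : Gam v s ∈ pathSpace := by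
  have hc := hX.continuous_variance hv0
  have hbound : ∀ t, |Gam v s t / (1 + |t|)| ≤ √(v |s|) * (√(v |t|) / (1 + |t|)) := by
    intro t
    rw [abs_div, abs_of_pos (show 0 < 1 + |t| by positivity), ← mul_div_assoc]
    gcongr
    exact hX.abs_Gam_le hv0 s t
  have hlim : ∀ l : Filter ℝ, Tendsto (fun t : ℝ => |t|) l atTop →
      Tendsto (fun t => Gam v s t / (1 + |t|)) l (𝓝 0) := by
    intro l hl
    refine squeeze_zero_norm hbound ?_
    have h1 := (hg.tendsto_sqrt_div.comp hl).const_mul (√(v |s|))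
    simpa using h1
  refine ⟨?_, ?_, hlim _ tendsto_abs_atTop_atTop, hlim _ tendsto_abs_atBot_atTop⟩
  · have h1 : Continuous fun t => v |t - s| := hc.comp (continuous_id.sub continuous_const)
    exact ((hc.sub h1).add continuous_const).div_const 2
  · simp [Gam, hv0]

lemma add_mem_pathSpace {f g : ℝ → ℝ} (hf : f ∈ pathSpace) (hg : g ∈ pathSpace) :
    (fun t => f t + g t) ∈ pathSpace := by
  refine ⟨hf.1.add hg.1, by simp [hf.2.1, hg.2.1], ?_, ?_⟩
  · simpa [add_div] using hf.2.2.1.add hg.2.2.1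
  · simpa [add_div] using hf.2.2.2.add hg.2.2.2

lemma const_mul_mem_pathSpace {f : ℝ → ℝ} (c : ℝ) (hf : f ∈ pathSpace) :
    (fun t => c * f t) ∈ pathSpace := by
  refine ⟨continuous_const.mul hf.1, by simp [hf.2.1], ?_, ?_⟩
  · simpa [mul_div_assoc] using hf.2.2.1.const_mul c
  · simpa [mul_div_assoc] using hf.2.2.2.const_mul c

/-- The minimal rate over `U^{s,t}` is `Υ(s, t)`. -/
theorem IsScaledSource.iInf_rate_eq (hX : IsScaledSource P v 1 X) (hv0 : v 0 = 0)
    (hg : SubquadraticGrowth v) (hv : RegularVariance v) {b c₁ c₂ s t : ℝ}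
    (hb : 0 < b) (hc₂ : 0 < c₂) (hc : c₂ < c₁) (ht : b / (c₁ - c₂) < t) (hs : s ∈ Ioo 0 t) :
    (⨅ f ∈ pathSetU b c₁ c₂ s t, rate v f) = ((Ups v b c₁ c₂ s t : ℝ) : EReal) := by
  obtain ⟨p, q, hp, hq, hy, hz, hval, hquad⟩ := hv.exists_multipliers hv0 hb hc₂ hc ht hs
  obtain ⟨hs0, hst⟩ := hs
  have ht0 : 0 < t := hs0.trans hst
  have hsum : Gam v s t = v t - Gam v (t - s) t := by
    rw [Gam_of_le hs0.le hst.le, Gam_of_le (by linarith) (by linarith), sub_sub_cancel]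
    ring
  have hWs : v s = 2 * Gam v s t - v t + v (t - s) := by
    rw [Gam_of_le hs0.le hst.le]
    ring
  -- The representer of f ↦ p(-f(-t)) + q(f(-s) - f(-t)), the two constraints weighted by their
  -- multipliers.
  set g : ℝ →₀ ℝ := q • Finsupp.single (-s) 1 - (p + q) • Finsupp.single (-t) 1 with hg_def
  have hGtt : Gam v (-t) (-t) = v t := by rw [Gam_neg_neg, Gam_self hv0, abs_of_pos ht0]
  have hGss : Gam v (-s) (-s) = v s := by rw [Gam_neg_neg, Gam_self hv0, abs_of_pos hs0]
  have hGst : Gam v (-s) (-t) = Gam v s t := Gam_neg_neg v s t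
  have hGts : Gam v (-t) (-s) = Gam v s t := by rw [Gam_neg_neg, Gam_comm]
  have hright : ∀ c : ℝ →₀ ℝ, gramForm v c g
      = q * kernelComb v c (-s) - (p + q) * kernelComb v c (-t) := by
    intro c
    rw [kernelComb_eq_gramForm, kernelComb_eq_gramForm, hg_def]
    simp only [map_sub, map_smul, smul_eq_mul]
  have hkern : ∀ r, kernelComb v g r = q * Gam v (-s) r + -(p + q) * Gam v (-t) r := by
    intro r
    rw [kernelComb_eq_gramForm, hg_def]
    simp only [map_sub, map_smul, LinearMap.sub_apply, LinearMap.smul_apply, smul_eq_mul,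
      gramForm_single]
    ring
  have hgg : gramForm v g g = 2 * Ups v b c₁ c₂ s t := by
    rw [hright, hkern, hkern, hGtt, hGss, hGst, hGts, ← hquad, hWs, hsum]
    ring
  have hUps : 0 ≤ 2 * Ups v b c₁ c₂ s t := hgg ▸ hX.gramForm_self_nonneg g
  refine le_antisymm ?_ (le_iInf₂ fun f hf => ?_)
  · have hlim : IsKernelLimit v (fun _ => g) (kernelComb v g) :=
      ⟨fun ε hε => ⟨0, fun m _ n _ => by simpa [kernelCombNorm] using hε⟩,
        fun t => tendsto_const_nhds⟩
    refine iInf₂_le_of_le (kernelComb v g) ⟨?_, ?_, ?_⟩ ?_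
    · rw [show kernelComb v g = _ from funext hkern]
      exact add_mem_pathSpace (const_mul_mem_pathSpace _ (hX.Gam_mem_pathSpace hv0 hg _))
        (const_mul_mem_pathSpace _ (hX.Gam_mem_pathSpace hv0 hg _))
    · rw [hkern, hGtt, hGst, hsum]
      linarith
    · rw [hkern, hkern, hGtt, hGst, hGss, hGts, hWs, hsum]
      linarith
    · have hmem : kernelComb v g ∈ rkhs v := ⟨_, hlim⟩
      have h0 : ∀ x ∈ {x | ∃ c, IsKernelLimit v c (kernelComb v g) ∧
          Tendsto (fun n => kernelCombNorm v (c n)) atTop (𝓝 x)}, 0 ≤ x := by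
        rintro x ⟨c, -, hx⟩
        exact ge_of_tendsto' hx fun n => kernelCombNorm_nonneg _ _
      have h1 : 0 ≤ rkhsNorm v (kernelComb v g) := Real.sInf_nonneg h0
      have h2 : rkhsNorm v (kernelComb v g) ≤ kernelCombNorm v g :=
        csInf_le ⟨0, h0⟩ ⟨_, hlim, tendsto_const_nhds⟩
      have h3 := pow_le_pow_left₀ h1 h2 2
      rw [hX.kernelCombNorm_sq, hgg] at h3
      rw [rate, if_pos hmem]
      exact EReal.coe_le_coe_iff.2 (by linarith)
  · obtain ⟨-, hf1, hf2⟩ := hf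
    rw [rate]
    split_ifs with hmem
    swap
    · exact le_top
    refine EReal.coe_le_coe_iff.2 ?_
    have hsqrt : √(2 * Ups v b c₁ c₂ s t) ≤ rkhsNorm v f := by
      obtain ⟨c, hcl⟩ := hmem
      obtain ⟨x, hx⟩ := hX.exists_tendsto_kernelCombNorm hcl
      refine le_csInf ⟨x, c, hcl, hx⟩ ?_
      rintro x ⟨c, hcl, hx⟩
      have hx0 : 0 ≤ x := ge_of_tendsto' hx fun n => kernelCombNorm_nonneg _ _
      refine Real.sqrt_le_iff.2 ⟨hx0, ?_⟩
      -- Expanding ‖c n - g‖² ≥ 0 leaves a pairing with g that involves only point values, so it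
      -- passes to the pointwise limit. Bounding every candidate norm x avoids proving that the
      -- limit of the norms is unique.
      have h1 : Tendsto (fun n => 2 * (q * kernelComb v (c n) (-s)
          - (p + q) * kernelComb v (c n) (-t)) - 2 * Ups v b c₁ c₂ s t) atTop
          (𝓝 (2 * (q * f (-s) - (p + q) * f (-t)) - 2 * Ups v b c₁ c₂ s t)) :=
        ((((hcl.tendsto _).const_mul _).sub ((hcl.tendsto _).const_mul _)).const_mul _).sub_const _
      have h2 : 2 * (q * f (-s) - (p + q) * f (-t)) - 2 * Ups v b c₁ c₂ s t ≤ x ^ 2 := by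
        refine le_of_tendsto_of_tendsto' h1 (hx.pow 2) fun n => ?_
        have h3 := hX.gramForm_self_nonneg (c n - g)
        simp only [map_sub, LinearMap.sub_apply, gramForm_comm v g (c n)] at h3
        rw [hX.kernelCombNorm_sq, ← hright, ← hgg]
        linarith
      nlinarith
    have h3 := Real.sqrt_le_iff.1 hsqrt
    linarith [h3.2]

end RKHS

end Tandem

namespace Tandem

/-! ### Deterministic description of overflow -/

section Queue

variable {X : ℝ → ℝ} {r₁ r₂ B : ℝ}

/-- A real supremum over an unbounded family is 0, so every `⨆` needs a bound. One bound at time 0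
for the slower rate r₂ serves the first queue at all earlier times. -/
lemma bddAbove_queue_terms (hr : r₂ ≤ r₁)
    (hbdd : BddAbove (range fun s : Ici (0 : ℝ) => -X (-s) - r₂ * s)) {t : ℝ} (ht : 0 ≤ t) :
    BddAbove (range fun s : Ici (0 : ℝ) => X (-t) - X (-t - s) - r₁ * s) := by
  obtain ⟨C, hC⟩ := hbdd
  refine ⟨C + X (-t) + r₂ * t, ?_⟩
  rintro _ ⟨⟨s, hs⟩, rfl⟩
  have hs' : 0 ≤ s := hs
  have h := hC ⟨⟨t + s, mem_Ici.2 (by positivity)⟩, rfl⟩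
  simp only [neg_add'] at h ⊢
  nlinarith

lemma secondQueue_zero (hX0 : X 0 = 0) : secondQueue r₁ r₂ X 0
    = ⨆ t : Ici (0 : ℝ), (-queue r₁ X 0 - X (-t) + queue r₁ X (-t) - r₂ * t) := by
  rw [secondQueue, queue]
  refine iSup_congr fun t => ?_
  rw [output, output, hX0, zero_sub, zero_sub]
  ring

/-- The witness adds two nearly optimal times: t for the second queue and u for the first queue at
-t. The subtracted content of the first queue at 0 is bounded below by its term for each s. -/
lemma exists_forall_lt_of_lt_secondQueue (hX0 : X 0 = 0) (hr : r₂ ≤ r₁)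
    (hbdd : BddAbove (range fun s : Ici (0 : ℝ) => -X (-s) - r₂ * s))
    (h : B < secondQueue r₁ r₂ X 0) :
    ∃ t, 0 ≤ t ∧ ∀ s, 0 ≤ s → B + r₂ * t - r₁ * s < X (-s) - X (-t) := by
  rw [secondQueue_zero hX0] at h
  obtain ⟨⟨t, ht⟩, h1⟩ := exists_lt_of_lt_ciSup h
  have ht' : 0 ≤ t := ht
  have h2 : B + queue r₁ X 0 + X (-t) + r₂ * t < queue r₁ X (-t) := by
    simp only at h1
    linarith
  obtain ⟨⟨u, hu⟩, h3⟩ := exists_lt_of_lt_ciSup h2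
  have hu' : 0 ≤ u := hu
  refine ⟨t + u, by positivity, fun s hs => ?_⟩
  have h4 := le_ciSup (bddAbove_queue_terms hr hbdd le_rfl) ⟨s, mem_Ici.2 hs⟩
  rw [neg_zero] at h4
  change X 0 - X (0 - s) - r₁ * s ≤ queue r₁ X 0 at h4
  simp only [hX0, zero_sub] at h4
  simp only [neg_add'] at h3 ⊢
  nlinarith

/-- Times s > t need no hypothesis: their term splits at t into the term at t and a term of the
first queue at -t. The slack η keeps the inequality strict after the supremum over s. -/
lemma lt_secondQueue_of_forall_le (hX0 : X 0 = 0) (hr : r₂ ≤ r₁)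
    (hbdd : BddAbove (range fun s : Ici (0 : ℝ) => -X (-s) - r₂ * s)) {t η : ℝ} (ht : 0 ≤ t)
    (hη : 0 < η) (h : ∀ s ∈ Icc 0 t, B + η + r₂ * t - r₁ * s ≤ X (-s) - X (-t)) :
    B < secondQueue r₁ r₂ X 0 := by
  have hqb := bddAbove_queue_terms hr hbdd ht
  have hq0 : 0 ≤ queue r₁ X (-t) := by
    have := le_ciSup hqb ⟨0, mem_Ici.2 le_rfl⟩
    simp only [sub_zero, sub_self, mul_zero] at this
    exact this
  have htt := h t ⟨ht, le_rfl⟩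
  have h1 : queue r₁ X 0 ≤ -X (-t) + queue r₁ X (-t) - r₂ * t - B - η := by
    have : Nonempty (Ici (0 : ℝ)) := ⟨⟨0, mem_Ici.2 le_rfl⟩⟩
    refine ciSup_le fun ⟨s, hs⟩ => ?_
    simp only [hX0, zero_sub]
    rcases le_total s t with hst | hst
    · have h2 := h s ⟨hs, hst⟩
      linarith
    · have h2 := le_ciSup hqb ⟨s - t, mem_Ici.2 (by linarith)⟩
      change X (-t) - X (-t - (s - t)) - r₁ * (s - t) ≤ queue r₁ X (-t) at h2
      rw [show -t - (s - t) = -s by ring] at h2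
      nlinarith
  rw [secondQueue_zero hX0]
  have hb2 : BddAbove (range fun t : Ici (0 : ℝ) =>
      -queue r₁ X 0 - X (-t) + queue r₁ X (-t) - r₂ * t) := by
    obtain ⟨C, hC⟩ := hbdd
    refine ⟨C - queue r₁ X 0, ?_⟩
    rintro _ ⟨⟨t, ht⟩, rfl⟩
    have ht' : 0 ≤ t := ht
    have h3 : queue r₁ X (-t) ≤ C + X (-t) + r₂ * t := by
      have : Nonempty (Ici (0 : ℝ)) := ⟨⟨0, mem_Ici.2 le_rfl⟩⟩
      refine ciSup_le fun ⟨s, hs⟩ => ?_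
      have hs' : 0 ≤ s := hs
      have h := hC ⟨⟨t + s, mem_Ici.2 (by positivity)⟩, rfl⟩
      simp only [neg_add'] at h ⊢
      nlinarith
    simp only
    linarith
  have h5 := le_ciSup hb2 ⟨t, mem_Ici.2 ht⟩
  simp only at h5
  linarith

end Queue

/-! ### Path events, supermultiplicativity and the Chernoff bound -/

section PathEvent

/-- The paths `x` with `φ(s) ≤ x(-s) - x(-t)` for all rational `s ∈ [0, t]`. -/
def pathEvent (t : ℝ) (φ : ℝ → ℝ) : Set (ℝ → ℝ) :=
  {x | ∀ q : ℚ, 0 ≤ (q : ℝ) → (q : ℝ) ≤ t → φ q ≤ x (-q) - x (-t)}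

lemma measurableSet_pathEvent (t : ℝ) (φ : ℝ → ℝ) : MeasurableSet (pathEvent t φ) := by
  have h : pathEvent t φ = ⋂ q : ℚ, {x | 0 ≤ (q : ℝ) → (q : ℝ) ≤ t → φ q ≤ x (-q) - x (-t)} := by
    ext x
    simp [pathEvent]
  rw [h]
  refine MeasurableSet.iInter fun q => ?_
  by_cases h0 : 0 ≤ (q : ℝ) <;> by_cases h1 : (q : ℝ) ≤ t
  · simp only [h0, h1, true_implies]
    exact measurableSet_le measurable_const (by fun_prop)
  all_goals simp [h0, h1]

/-- Rational times make the event measurable in the product σ-algebra; density and continuity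
restore the constraint at real times. -/
lemma le_of_mem_pathEvent {t : ℝ} {φ x : ℝ → ℝ} (ht : 0 < t) (hφ : Continuous φ)
    (hx : Continuous x) (h : x ∈ pathEvent t φ) {s : ℝ} (hs : s ∈ Icc 0 t) :
    φ s ≤ x (-s) - x (-t) := by
  have hcl : IsClosed {s | φ s ≤ x (-s) - x (-t)} :=
    isClosed_le hφ (by fun_prop)
  have hd : Ioo 0 t ⊆ closure (Ioo 0 t ∩ range ((↑) : ℚ → ℝ)) :=
    Rat.denseRange_cast.open_subset_closure_inter isOpen_Ioo
  have h1 : Ioo 0 t ∩ range ((↑) : ℚ → ℝ) ⊆ {s | φ s ≤ x (-s) - x (-t)} := by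
    rintro _ ⟨⟨h2, h3⟩, q, rfl⟩
    exact h q h2.le h3.le
  have h2 : closure (Ioo 0 t) ⊆ {s | φ s ≤ x (-s) - x (-t)} :=
    closure_minimal (hd.trans (closure_minimal h1 hcl)) hcl
  rw [closure_Ioo ht.ne] at h2
  exact h2 hs

lemma pathEvent_anti {t : ℝ} {φ ψ : ℝ → ℝ} (h : ∀ s ∈ Icc 0 t, φ s ≤ ψ s) :
    pathEvent t ψ ⊆ pathEvent t φ :=
  fun _ hx q h0 h1 => (h q ⟨h0, h1⟩).trans (hx q h0 h1)

variable {Ω : Type*} [MeasurableSpace Ω] {P : Measure Ω}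
  {v : ℝ → ℝ} {A : ℕ → ℝ → Ω → ℝ}

/-- The probability that the sum of the first `n` sources is in `pathEvent t φ`. -/
def pathProb (P : Measure Ω) (A : ℕ → ℝ → Ω → ℝ) (n : ℕ) (t : ℝ) (φ : ℝ → ℝ) : ENNReal :=
  P {ω | (fun u => ∑ i ∈ Finset.range n, A i u ω) ∈ pathEvent t φ}

lemma pathProb_anti {n : ℕ} {t : ℝ} {φ ψ : ℝ → ℝ} (h : ∀ s ∈ Icc 0 t, φ s ≤ ψ s) :
    pathProb P A n t ψ ≤ pathProb P A n t φ :=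
  measure_mono fun ω (hω : (fun u => ∑ i ∈ Finset.range n, A i u ω) ∈ pathEvent t ψ) =>
    pathEvent_anti h hω

namespace IsIIDGaussianSources

variable [IsProbabilityMeasure P]

lemma isScaledSource_range (hA : IsIIDGaussianSources P v A) (n : ℕ) :
    IsScaledSource P v n (fun t ω => ∑ i ∈ Finset.range n, A i t ω) := by
  simpa using hA.isScaledSource_sum (Finset.range n)

lemma pathProb_eq (hA : IsIIDGaussianSources P v A) {n : ℕ} {X : ℝ → Ω → ℝ}
    (hX : IsScaledSource P v n X) (t : ℝ) (φ : ℝ → ℝ) :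
    pathProb P A n t φ = P {ω | (fun u => X u ω) ∈ pathEvent t φ} :=
  (hA.isScaledSource_range n).measure_eq hX (measurableSet_pathEvent t φ)

/-- Disjoint blocks of sources are independent, the law of a block depends only on its size, and
barriers add along with the paths. -/
lemma pathProb_mul_le (hA : IsIIDGaussianSources P v A) (n m : ℕ) {t : ℝ} {φ ψ χ : ℝ → ℝ}
    (h : ∀ s ∈ Icc 0 t, χ s ≤ φ s + ψ s) :
    pathProb P A n t φ * pathProb P A m t ψ ≤ pathProb P A (n + m) t χ := by
  have hd : Disjoint (Finset.range n) (Finset.Ico n (n + m)) := by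
    rw [Finset.range_eq_Ico]
    exact Finset.Ico_disjoint_Ico_consecutive 0 n (n + m)
  have hind := hA.indepFun_sum hd
  have h2 := hA.isScaledSource_sum (Finset.Ico n (n + m))
  rw [Nat.card_Ico, Nat.add_sub_cancel_left] at h2
  rw [hA.pathProb_eq h2 t ψ, pathProb]
  have h3 := hind.measure_inter_preimage_eq_mul _ _ (measurableSet_pathEvent t φ)
    (measurableSet_pathEvent t ψ)
  refine h3.ge.trans (measure_mono ?_)
  rintro ω ⟨h4, h5⟩ q hq0 hqt
  have h6 := h4 q hq0 hqt
  have h7 := h5 q hq0 hqt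
  have h8 := h q ⟨hq0, hqt⟩
  simp only at h6 h7 ⊢
  rw [← Finset.sum_range_add_sum_Ico _ (Nat.le_add_right n m),
    ← Finset.sum_range_add_sum_Ico _ (Nat.le_add_right n m)]
  linarith

/-- Chernoff bound: the exponential decay rate of the path event is at least `Υ(s, t)`. -/
theorem pathProb_le_exp_Ups (hA : IsIIDGaussianSources P v A) (hv : RegularVariance v)
    {b c₁ c₂ s t : ℝ} (hb : 0 < b) (hc₂ : 0 < c₂) (hc : c₂ < c₁) (ht : b / (c₁ - c₂) < t)
    (hs : s ∈ Ioo 0 t) (n : ℕ) :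
    pathProb P A n t (fun s => n * (b + c₂ * t - c₁ * s))
      ≤ ENNReal.ofReal (Real.exp (-(n * Ups v b c₁ c₂ s t))) := by
  have hv0 : v 0 = 0 := (hA.source 0).v_zero
  have hX := hA.isScaledSource_range n
  set X : ℝ → Ω → ℝ := fun t ω => ∑ i ∈ Finset.range n, A i t ω with hXdef
  obtain ⟨p, q, hp, hq, -, -, hval, hquad⟩ := hv.exists_multipliers hv0 hb hc₂ hc ht hs
  obtain ⟨hs0, hst⟩ := hs
  have ht0 : 0 < t := hs0.trans hst
  set W : Ω → ℝ := fun ω => q * X (-s) ω - (p + q) * X (-t) ω with hW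
  have hWG : HasGaussianLaw W P := by
    have h1 := (hX.gaussian.hasGaussianLaw_prodMk (s := -s) (t := -t)).map_fun
      (q • ContinuousLinearMap.fst ℝ ℝ ℝ - (p + q) • ContinuousLinearMap.snd ℝ ℝ ℝ)
    simpa using h1
  have hWmean : ∫ ω, W ω ∂P = 0 := by
    rw [hW, integral_sub (((hX.memLp _).integrable (by norm_num)).const_mul _)
      (((hX.memLp _).integrable (by norm_num)).const_mul _), integral_const_mul,
      integral_const_mul, hX.centered, hX.centered]
    simp
  have hWvar : Var[W; P] = n * (2 * Ups v b c₁ c₂ s t) := by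
    rw [← covariance_self hWG.aemeasurable, hW,
      covariance_fun_sub_fun_sub ((hX.memLp _).const_mul _) ((hX.memLp _).const_mul _)
        ((hX.memLp _).const_mul _) ((hX.memLp _).const_mul _)]
    simp only [covariance_const_mul_left, covariance_const_mul_right, hX.covariance_eq,
      Gam_neg_neg]
    rw [Gam_self hv0, Gam_self hv0, abs_of_pos hs0, abs_of_pos ht0, Gam_comm v t s, ← hquad,
      Gam_of_le hs0.le hst.le, Gam_of_le (show 0 ≤ t - s by linarith) (by linarith),
      sub_sub_cancel]
    ring
  have hmap := hWG.map_eq_gaussianReal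
  -- On the event W is at least 2nΥ, which is also its variance, so the optimal Chernoff parameter
  -- is 1 and the exponent is -2nΥ + nΥ.
  have hmgf := mgf_gaussianReal hmap 1
  rw [hWmean, Real.coe_toNNReal _ (variance_nonneg _ _), hWvar] at hmgf
  have hint : Integrable (fun ω => Real.exp (1 * W ω)) P := by
    rw [← mgf_pos_iff, hmgf]
    exact Real.exp_pos _
  have hch := measure_ge_le_exp_mul_mgf (n * (2 * Ups v b c₁ c₂ s t)) zero_le_one hint
  rw [hmgf, ← Real.exp_add] at hch
  have hsub : {ω | (fun u => X u ω) ∈ pathEvent t (fun s => n * (b + c₂ * t - c₁ * s))}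
      ⊆ {ω | n * (2 * Ups v b c₁ c₂ s t) ≤ W ω} := by
    intro ω hω
    have hω' : (fun u => X u ω) ∈ pathEvent t (fun s => n * (b + c₂ * t - c₁ * s)) := hω
    have h1 := le_of_mem_pathEvent ht0 (by fun_prop) (hX.continuous_paths ω) hω'
      (s := s) ⟨hs0.le, hst.le⟩
    have h2 := le_of_mem_pathEvent ht0 (by fun_prop) (hX.continuous_paths ω) hω'
      (s := 0) ⟨le_rfl, ht0.le⟩
    simp only [neg_zero, hX.start_zero, mul_zero, sub_zero, zero_sub] at h1 h2
    have h3 := mul_le_mul_of_nonneg_left h1 hq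
    have h4 := mul_le_mul_of_nonneg_left h2 hp
    rw [mem_ofPred_eq, ← hval, hW]
    linarith
  refine (measure_mono hsub).trans ?_
  rw [← ofReal_measureReal]
  refine ENNReal.ofReal_le_ofReal (hch.trans_eq ?_)
  congr 1
  ring

end IsIIDGaussianSources

end PathEvent

end Tandem

namespace Tandem

/-! ### Reduction of suprema to countably many times -/

section DenseTimes

lemma exists_lt_iff_exists_denseSeq {g p : ℝ → ℝ} (hg : Continuous g) (hp : Continuous p) {x : ℝ} :
    (∃ u, x < g (p u)) ↔ ∃ i : ℕ, x < g (p (TopologicalSpace.denseSeq ℝ i)) := by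
  constructor
  · rintro ⟨u, hu⟩
    have ho : IsOpen {u | x < g (p u)} := isOpen_lt continuous_const (hg.comp hp)
    obtain ⟨_, h1, i, rfl⟩ := (TopologicalSpace.denseRange_denseSeq ℝ).inter_open_nonempty _ ho ⟨u, hu⟩
    exact ⟨i, h1⟩
  · rintro ⟨i, hi⟩
    exact ⟨_, hi⟩

/-- Times that are dense in `[-h, h]`. -/
noncomputable def clampTime (h : ℝ) (i : ℕ) : ℝ := max (-h) (min h (TopologicalSpace.denseSeq ℝ i))

lemma exists_Icc_lt_iff {f : ℝ → ℝ} (hf : Continuous f) {h : ℝ} (hh : 0 ≤ h) {x : ℝ} :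
    (∃ u ∈ Icc (-h) h, x < |f u|) ↔ ∃ i, x < |f (clampTime h i)| := by
  refine Iff.trans ?_ (exists_lt_iff_exists_denseSeq (g := fun u => |f u|)
    (p := fun u => max (-h) (min h u)) (by fun_prop) (by fun_prop))
  constructor
  · rintro ⟨u, ⟨h1, h2⟩, hu⟩
    exact ⟨u, by rwa [min_eq_right h2, max_eq_right h1]⟩
  · rintro ⟨u, hu⟩
    exact ⟨_, ⟨le_max_left _ _, max_le (by linarith) (min_le_left _ _)⟩, hu⟩

/-- Times that are dense in `(-∞, -T]`. -/
noncomputable def farTime (T : ℝ) (i : ℕ) : ℝ := max T (TopologicalSpace.denseSeq ℝ i)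

/-- Dividing by t replaces the linear barrier by a constant level for a weighted sequence, the form
needed for the Fernique bound. -/
lemma exists_ge_lt_iff {f : ℝ → ℝ} (hf : Continuous f) {T : ℝ} (hT : 0 < T) {x : ℝ} :
    (∃ t, T ≤ t ∧ x * t < |f (-t)|) ↔ ∃ i, x < |(farTime T i)⁻¹ * f (-farTime T i)| := by
  have hpos : ∀ u, 0 < max T u := fun u => hT.trans_le (le_max_left _ _)
  have hne : ∀ u, max T u ≠ 0 := fun u => (hpos u).ne'
  have h1 := exists_lt_iff_exists_denseSeq (g := fun u => u)
    (p := fun u => |(max T u)⁻¹ * f (-max T u)|) (x := x) continuous_id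
    ((((by fun_prop : Continuous fun u : ℝ => max T u).inv₀ hne).mul (by fun_prop)).abs)
  have h2 : ∀ t, 0 < t → (x < |t⁻¹ * f (-t)| ↔ x * t < |f (-t)|) := by
    intro t ht
    rw [abs_mul, abs_of_pos (inv_pos.2 ht), inv_mul_eq_div, lt_div_iff₀ ht]
  refine Iff.trans ?_ h1
  constructor
  · rintro ⟨t, ht, hx⟩
    refine ⟨t, ?_⟩
    rw [max_eq_right ht]
    exact (h2 t (hT.trans_le ht)).2 hx
  · rintro ⟨u, hu⟩
    exact ⟨max T u, le_max_left _ _, (h2 _ (hpos u)).1 hu⟩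

end DenseTimes

lemma summable_exp_neg_mul_rpow {c γ : ℝ} (hc : 0 < c) (hγ : 0 < γ) :
    Summable fun k : ℕ => Real.exp (-c * (k : ℝ) ^ γ) := by
  have h1 := (isLittleO_exp_neg_mul_rpow_atTop hc (-2 / γ)).comp_tendsto
    ((tendsto_rpow_atTop hγ).comp tendsto_natCast_atTop_atTop)
  refine summable_of_isBigO_nat (g := fun k : ℕ => (k : ℝ) ^ (-2 : ℝ))
    (Real.summable_nat_rpow.2 (by norm_num)) (h1.isBigO.congr_right fun k => ?_)
  simp only [Function.comp]
  rw [← Real.rpow_mul (by positivity), mul_div_cancel₀ _ hγ.ne']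

/-! ### Exponential bounds for increments and for the distant past -/

section SupBounds

variable {Ω : Type*} [MeasurableSpace Ω] {P : Measure Ω} {v : ℝ → ℝ} {Y : ℝ → Ω → ℝ}

namespace IsScaledSource

variable {k : ℝ} {X : ℝ → Ω → ℝ}

lemma nullMeasurableSet_exists_lt (hX : IsScaledSource P v k X) (τ w : ℕ → ℝ) (x : ℝ) :
    NullMeasurableSet {ω | ∃ i, x < |w i * X (τ i) ω|} P := by
  have h : {ω | ∃ i, x < |w i * X (τ i) ω|} = ⋃ i, {ω | x < |w i * X (τ i) ω|} := by
    ext ω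
    simp
  rw [h]
  refine NullMeasurableSet.iUnion fun i => nullMeasurableSet_lt aemeasurable_const ?_
  have := (hX.memLp (τ i)).aemeasurable
  fun_prop

end IsScaledSource

variable [IsProbabilityMeasure P]

/-- Supplies the threshold 1/4 of `exists_gaussian_sup_tail_bound` by a soft argument, without any
estimate of expected suprema. -/
lemma measure_le_quarter_of_antitone {E : ℕ → Set Ω} (hm : ∀ k, NullMeasurableSet (E k) P)
    (hanti : Antitone E) (hempty : ⋂ k, E k = ∅) : ∃ k, P (E k) ≤ 1 / 4 := by
  have h := tendsto_measure_iInter_atTop hm hanti ⟨0, measure_ne_top P _⟩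
  rw [hempty, measure_empty] at h
  obtain ⟨k, hk⟩ := (h.eventually (gt_mem_nhds (show (0 : ENNReal) < 1 / 4 by simp))).exists
  exact ⟨k, hk.le⟩

namespace IsScaledSource

/-- Exponential bounds for weighted suprema of superposed sources. -/
theorem exists_sup_bound (hY : IsScaledSource P v 1 Y) {ε : ℝ} (hε : 0 < ε) (M : ℝ) :
    ∃ a, 0 < a ∧ ∀ τ w : ℕ → ℝ, P {ω | ∃ i, a < |w i * Y (τ i) ω|} ≤ 1 / 4 →
      ∀ n : ℕ, 1 ≤ n → ∀ X : ℝ → Ω → ℝ, IsScaledSource P v n X →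
      P {ω | ∃ i, n * ε < |w i * X (τ i) ω|} ≤ ENNReal.ofReal (Real.exp (-(n * M))) := by
  obtain ⟨κ, C, hκ, hC, hF⟩ := exists_gaussian_sup_tail_bound P
  set D : ℝ := |M| + Real.log C + 1 with hD
  have hlogC := Real.log_nonneg hC
  have hDpos : 0 < D := by positivity
  -- X has the law of √n Y, so the level nε becomes √n ε. This a makes the Fernique exponent equal
  -- to nD, where D exceeds M by enough to absorb the prefactor C.
  refine ⟨ε * √(κ / D), by positivity, fun τ w hP n hn X hX => ?_⟩
  have hn0 : (0 : ℝ) < n := by positivity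
  have hn1 : (1 : ℝ) ≤ n := by exact_mod_cast hn
  have hZ := hY.const_mul √n
  rw [Real.sq_sqrt hn0.le, mul_one] at hZ
  have hS : MeasurableSet {x : ℝ → ℝ | ∃ i, n * ε < |w i * x (τ i)|} := by
    have h : {x : ℝ → ℝ | ∃ i, n * ε < |w i * x (τ i)|}
        = ⋃ i, {x : ℝ → ℝ | n * ε < |w i * x (τ i)|} := by
      ext x
      simp
    rw [h]
    exact MeasurableSet.iUnion fun i => measurableSet_lt measurable_const (by fun_prop)
  have hlaw := hX.measure_eq hZ hS
  have hG : IsGaussianProcess (fun i ω => w i * Y (τ i) ω) P :=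
    (hY.gaussian.comp_right τ).smul w
  have hb := hF _ hG (fun i => by rw [integral_const_mul, hY.centered, mul_zero]) _
    (show 0 < ε * √(κ / D) by positivity) hP (√n * ε) (by positivity)
  have hset : {ω | (fun t => √n * Y t ω) ∈ {x : ℝ → ℝ | ∃ i, n * ε < |w i * x (τ i)|}}
      = {ω | ∃ i, √n * ε < |w i * Y (τ i) ω|} := by
    ext ω
    simp only [mem_ofPred_eq]
    refine exists_congr fun i => ?_
    have h1 : 0 < √(n : ℝ) := Real.sqrt_pos.2 hn0
    rw [mul_left_comm, abs_mul, abs_of_pos h1]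
    nth_rewrite 1 [← Real.mul_self_sqrt hn0.le]
    rw [mul_assoc, mul_lt_mul_iff_right₀ h1]
  rw [hset] at hlaw
  refine hlaw.trans_le (hb.trans (ENNReal.ofReal_le_ofReal ?_))
  have h2 : κ * (√n * ε / (ε * √(κ / D))) ^ 2 = n * D := by
    rw [div_pow, mul_pow, mul_pow, Real.sq_sqrt hn0.le, Real.sq_sqrt (by positivity)]
    field_simp
  rw [h2]
  nth_rewrite 1 [← Real.exp_log (show 0 < C by linarith)]
  rw [← Real.exp_add]
  refine Real.exp_le_exp.2 ?_
  have h3 := le_abs_self M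
  nlinarith

lemma exists_Icc_measure_le (hY : IsScaledSource P v 1 Y) {a : ℝ} (ha : 0 < a) :
    ∃ h, 0 < h ∧ P {ω | ∃ u ∈ Icc (-h) h, a < |Y u ω|} ≤ 1 / 4 := by
  suffices h : ∃ k : ℕ,
      P {ω | ∃ u ∈ Icc (-(1 / ((k : ℝ) + 1))) (1 / ((k : ℝ) + 1)), a < |Y u ω|} ≤ 1 / 4 by
    obtain ⟨k, hk⟩ := h
    exact ⟨1 / ((k : ℝ) + 1), by positivity, hk⟩
  refine measure_le_quarter_of_antitone (P := P)
    (E := fun k : ℕ => {ω | ∃ u ∈ Icc (-(1 / ((k : ℝ) + 1))) (1 / ((k : ℝ) + 1)), a < |Y u ω|})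
    (fun k => ?_) ?_ ?_
  · simp only [exists_Icc_lt_iff (hY.continuous_paths _)
      (show 0 ≤ 1 / ((k : ℝ) + 1) by positivity)]
    simpa using hY.nullMeasurableSet_exists_lt (clampTime (1 / ((k : ℝ) + 1))) (fun _ => 1) a
  · rintro k l hkl ω ⟨u, hu, hau⟩
    have h1 : 1 / ((l : ℝ) + 1) ≤ 1 / ((k : ℝ) + 1) := Nat.one_div_le_one_div hkl
    exact ⟨u, ⟨by linarith [hu.1], hu.2.trans h1⟩, hau⟩
  · refine eq_empty_of_forall_notMem fun ω hω => ?_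
    rw [mem_iInter] at hω
    have hc := (hY.continuous_paths ω).abs.tendsto 0
    rw [hY.start_zero, abs_zero] at hc
    obtain ⟨δ, hδ, hball⟩ := Metric.eventually_nhds_iff.1 (hc.eventually (gt_mem_nhds ha))
    obtain ⟨k, hk⟩ := exists_nat_one_div_lt hδ
    obtain ⟨u, hu, hau⟩ := hω k
    refine absurd (hball (y := u) ?_) (not_lt.2 hau.le)
    rw [Real.dist_eq, sub_zero]
    exact (abs_le.2 hu).trans_lt hk

lemma exists_bound_Icc_measure_le (hY : IsScaledSource P v 1 Y) {h : ℝ} (hh : 0 ≤ h) :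
    ∃ a, 0 < a ∧ P {ω | ∃ u ∈ Icc (-h) h, a < |Y u ω|} ≤ 1 / 4 := by
  suffices h : ∃ k : ℕ, P {ω | ∃ u ∈ Icc (-h) h, (k : ℝ) + 1 < |Y u ω|} ≤ 1 / 4 by
    obtain ⟨k, hk⟩ := h
    exact ⟨(k : ℝ) + 1, by positivity, hk⟩
  refine measure_le_quarter_of_antitone (P := P)
    (E := fun k : ℕ => {ω | ∃ u ∈ Icc (-h) h, (k : ℝ) + 1 < |Y u ω|}) (fun k => ?_) ?_ ?_
  · simp only [exists_Icc_lt_iff (hY.continuous_paths _) hh]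
    simpa using hY.nullMeasurableSet_exists_lt (clampTime h) (fun _ => 1) ((k : ℝ) + 1)
  · rintro k l hkl ω ⟨u, hu, hau⟩
    have h1 : (k : ℝ) ≤ l := by exact_mod_cast hkl
    exact ⟨u, hu, by linarith⟩
  · refine eq_empty_of_forall_notMem fun ω hω => ?_
    rw [mem_iInter] at hω
    obtain ⟨C, hC⟩ := (isCompact_Icc (a := -h) (b := h)).exists_bound_of_continuousOn
      (hY.continuous_paths ω).continuousOn
    obtain ⟨k, hk⟩ := exists_nat_gt C
    obtain ⟨u, hu, hau⟩ := hω k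
    have := hC u hu
    rw [Real.norm_eq_abs] at this
    linarith

/-- Large increments over short intervals are exponentially unlikely. -/
theorem exists_modulus_bound (hY : IsScaledSource P v 1 Y) (hv0 : v 0 = 0) {ε : ℝ} (hε : 0 < ε)
    (M : ℝ) : ∃ h, 0 < h ∧ ∀ n : ℕ, 1 ≤ n → ∀ X : ℝ → Ω → ℝ, IsScaledSource P v n X → ∀ c,
      P {ω | ∃ u ∈ Icc (-h) h, n * ε < |X (c + u) ω - X c ω|}
        ≤ ENNReal.ofReal (Real.exp (-(n * M))) := by
  obtain ⟨a, ha, hb⟩ := hY.exists_sup_bound hε M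
  obtain ⟨h, hh, hq⟩ := hY.exists_Icc_measure_le ha
  refine ⟨h, hh, fun n hn X hX c => ?_⟩
  -- Increments from c have the same law as those from 0, so h does not depend on c.
  have hX' := hX.shift hv0 c
  simp only [exists_Icc_lt_iff (hY.continuous_paths _) hh.le] at hq
  simp only [exists_Icc_lt_iff (hX'.continuous_paths _) hh.le]
  simpa using hb (clampTime h) (fun _ => 1) (by simpa using hq) n hn _ hX'

/-- If |Y(-t)| > at with k ≤ t < k + 1, then |Y(-k)| or the increment from -k to -t exceeds ak/2.
Both have probability at most C exp(-c k^γ) with γ = 2 - β, which is summable. -/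
lemma exists_tail_measure_le (hY : IsScaledSource P v 1 Y) (hv : RegularVariance v)
    (hv0 : v 0 = 0) (hg : SubquadraticGrowth v) {a : ℝ} (ha : 0 < a) :
    ∃ T, 0 < T ∧ P {ω | ∃ t, T ≤ t ∧ a * t < |Y (-t) ω|} ≤ 1 / 4 := by
  obtain ⟨κ, C, hκ, hC, hF⟩ := exists_gaussian_sup_tail_bound P
  obtain ⟨β, hβ1, hβ2, hβ⟩ := hg.exists_eventually_le_rpow
  obtain ⟨T₀, hT₀⟩ := eventually_atTop.1 hβ
  obtain ⟨a₁, ha₁, hq⟩ := hY.exists_bound_Icc_measure_le zero_le_one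
  set γ := 2 - β with hγ
  -- The Fernique rates for level ak/2, with reference levels 2√v(k) at the integer point and a₁ for
  -- the increments.
  set c := min (κ * a ^ 2 / 16) (κ * a ^ 2 / (4 * a₁ ^ 2)) with hc
  have hcpos : 0 < c := by positivity
  have hγpos : 0 < γ := by linarith
  have hsum := summable_exp_neg_mul_rpow hcpos hγpos
  have hpoint : ∀ k : ℕ, 1 ≤ k → T₀ ≤ k → P {ω | a * k / 2 < |Y (-k) ω|}
      ≤ ENNReal.ofReal (C * Real.exp (-c * (k : ℝ) ^ γ)) := by
    intro k hk hTk
    have hk0 : (0 : ℝ) < k := by positivity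
    have hvk := hv.pos hk0
    have hcheb : P {ω | ∃ i : ℕ, 2 * √(v k) < |Y (-k) ω|} ≤ 1 / 4 := by
      have h1 := meas_ge_le_variance_div_sq (hY.memLp (-k)) (show 0 < 2 * √(v k) by positivity)
      rw [hY.centered, hY.variance_eq hv0, abs_neg, abs_of_pos hk0, mul_pow,
        Real.sq_sqrt hvk.le] at h1
      refine (measure_mono ?_).trans (h1.trans_eq ?_)
      · rintro ω ⟨-, h2⟩
        simp only [mem_ofPred_eq, sub_zero]
        exact h2.le
      · rw [show 1 * v k / (2 ^ 2 * v k) = 1 / 4 by field_simp; norm_num,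
          ENNReal.ofReal_div_of_pos (by norm_num)]
        simp
    have h3 := hF (fun _ => Y (-k)) (hY.gaussian.comp_right fun _ => -k)
      (fun _ => hY.centered _) _ (show 0 < 2 * √(v k) by positivity) hcheb (a * k / 2)
      (by positivity)
    have h5 : {ω | a * k / 2 < |Y (-k) ω|} ⊆ {ω | ∃ i : ℕ, a * k / 2 < |Y (-k) ω|} :=
      fun ω hω => ⟨0, hω⟩
    refine (measure_mono h5).trans (h3.trans (ENNReal.ofReal_le_ofReal ?_))
    gcongr
    rw [neg_mul, neg_le_neg_iff, div_pow, mul_pow, Real.sq_sqrt hvk.le]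
    have h4 : (k : ℝ) ^ γ * v k ≤ k ^ 2 := by
      calc (k : ℝ) ^ γ * v k ≤ (k : ℝ) ^ γ * (k : ℝ) ^ β := by gcongr; exact hT₀ k hTk
        _ = (k : ℝ) ^ 2 := by
          rw [← Real.rpow_add hk0, hγ, sub_add_cancel]
          norm_num
    calc c * (k : ℝ) ^ γ ≤ κ * a ^ 2 / 16 * (k : ℝ) ^ γ := by gcongr; exact min_le_left _ _
      _ ≤ κ * ((a * k / 2) ^ 2 / (2 ^ 2 * v k)) := by
        rw [← mul_div_assoc, le_div_iff₀ (by positivity)]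
        nlinarith [mul_le_mul_of_nonneg_left h4 (show 0 ≤ κ * a ^ 2 by positivity)]
  have hlocal : ∀ k : ℕ, 1 ≤ k →
      P {ω | ∃ u ∈ Icc (-1 : ℝ) 1, a * k / 2 < |Y (-k + u) ω - Y (-k) ω|}
      ≤ ENNReal.ofReal (C * Real.exp (-c * (k : ℝ) ^ γ)) := by
    intro k hk
    have hk1 : (1 : ℝ) ≤ k := by exact_mod_cast hk
    have hk0 : (0 : ℝ) < k := by positivity
    have hY' := hY.shift hv0 (-k)
    have hq' : P {ω | ∃ i, a₁ < |Y (-k + clampTime 1 i) ω - Y (-k) ω|} ≤ 1 / 4 := by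
      simp only [exists_Icc_lt_iff (hY.continuous_paths _) zero_le_one] at hq
      refine le_trans (le_of_eq ?_) hq
      have hS : MeasurableSet {x : ℝ → ℝ | ∃ i, a₁ < |x (clampTime 1 i)|} := by
        have h : {x : ℝ → ℝ | ∃ i, a₁ < |x (clampTime 1 i)|}
            = ⋃ i, {x : ℝ → ℝ | a₁ < |x (clampTime 1 i)|} := by
          ext x
          simp
        rw [h]
        exact MeasurableSet.iUnion fun i => measurableSet_lt measurable_const (by fun_prop)
      exact hY'.measure_eq hY hS
    simp only [exists_Icc_lt_iff (hY'.continuous_paths _) zero_le_one]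
    have h3 := hF _ (hY'.gaussian.comp_right (clampTime 1)) (fun i => hY'.centered _) a₁ ha₁ hq'
      (a * k / 2) (by positivity)
    refine h3.trans (ENNReal.ofReal_le_ofReal ?_)
    gcongr
    rw [neg_mul, neg_le_neg_iff]
    have h4 : (k : ℝ) ^ γ ≤ k ^ 2 := by
      rw [← Real.rpow_natCast]
      exact Real.rpow_le_rpow_of_exponent_le hk1 (by push_cast; linarith)
    calc c * (k : ℝ) ^ γ ≤ κ * a ^ 2 / (4 * a₁ ^ 2) * (k : ℝ) ^ 2 := by
          gcongr
          exact min_le_right _ _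
      _ = κ * (a * k / 2 / a₁) ^ 2 := by
        field_simp
        ring
  have hlim : Tendsto (fun N : ℕ => ∑' k : ℕ,
      2 * ENNReal.ofReal (C * Real.exp (-c * ((k + N : ℕ) : ℝ) ^ γ))) atTop (𝓝 0) := by
    have h1 : ∀ k : ℕ, 2 * ENNReal.ofReal (C * Real.exp (-c * (k : ℝ) ^ γ))
        = ENNReal.ofReal (2 * (C * Real.exp (-c * (k : ℝ) ^ γ))) := by
      intro k
      rw [ENNReal.ofReal_mul (by norm_num : (0 : ℝ) ≤ 2)]
      simp
    simp_rw [h1]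
    exact ENNReal.tendsto_sum_nat_add
      (fun k : ℕ => ENNReal.ofReal (2 * (C * Real.exp (-c * (k : ℝ) ^ γ))))
      (((hsum.mul_left C).mul_left 2).tsum_ofReal_ne_top)
  obtain ⟨N, hN, hN1, hNT⟩ := ((hlim.eventually (gt_mem_nhds
    (show (0 : ENNReal) < 1 / 4 by simp))).and ((eventually_ge_atTop 1).and
      (tendsto_natCast_atTop_atTop.eventually_ge_atTop T₀))).exists
  refine ⟨N, by positivity, le_trans ?_ hN.le⟩
  have hsub : {ω | ∃ t, (N : ℝ) ≤ t ∧ a * t < |Y (-t) ω|} ⊆ ⋃ k : ℕ,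
      ({ω | a * (k + N : ℕ) / 2 < |Y (-(k + N : ℕ)) ω|} ∪
        {ω | ∃ u ∈ Icc (-1 : ℝ) 1, a * (k + N : ℕ) / 2
          < |Y (-(k + N : ℕ) + u) ω - Y (-(k + N : ℕ)) ω|}) := by
    rintro ω ⟨t, ht, hat⟩
    have ht0 : 0 ≤ t := le_trans (by positivity) ht
    have hfl : N ≤ ⌊t⌋₊ := Nat.le_floor ht
    refine mem_iUnion.2 ⟨⌊t⌋₊ - N, ?_⟩
    rw [Nat.sub_add_cancel hfl]
    have h1 := Nat.floor_le ht0
    have h2 := Nat.lt_floor_add_one t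
    by_contra hcon
    rw [mem_union, not_or] at hcon
    obtain ⟨h3, h4⟩ := hcon
    simp only [mem_ofPred_eq, not_lt, not_exists, not_and] at h3 h4
    have h5 := h4 (⌊t⌋₊ - t) ⟨by linarith, by linarith⟩
    rw [show -(⌊t⌋₊ : ℝ) + (⌊t⌋₊ - t) = -t by ring] at h5
    have h6 := abs_sub_abs_le_abs_sub (Y (-t) ω) (Y (-⌊t⌋₊) ω)
    have h7 := mul_le_mul_of_nonneg_left h1 ha.le
    linarith
  refine (measure_mono hsub).trans ((measure_iUnion_le _).trans (ENNReal.tsum_le_tsum fun k => ?_))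
  have hkN : 1 ≤ k + N := by omega
  have hkT : T₀ ≤ (k + N : ℕ) := by
    push_cast
    have : (0 : ℝ) ≤ k := by positivity
    linarith
  rw [two_mul]
  exact (measure_union_le _ _).trans (add_le_add (hpoint _ hkN hkT) (hlocal _ hkN))

/-- Large values far in the past are exponentially unlikely. -/
theorem exists_tail_bound (hY : IsScaledSource P v 1 Y) (hv : RegularVariance v)
    (hv0 : v 0 = 0) (hg : SubquadraticGrowth v) {ε : ℝ} (hε : 0 < ε) (M : ℝ) :
    ∃ T, 0 < T ∧ ∀ n : ℕ, 1 ≤ n → ∀ X : ℝ → Ω → ℝ, IsScaledSource P v n X →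
      P {ω | ∃ t, T ≤ t ∧ n * ε * t < |X (-t) ω|} ≤ ENNReal.ofReal (Real.exp (-(n * M))) := by
  obtain ⟨a, ha, hb⟩ := hY.exists_sup_bound hε M
  obtain ⟨T, hT, hq⟩ := hY.exists_tail_measure_le hv hv0 hg ha
  refine ⟨T, hT, fun n hn X hX => ?_⟩
  simp only [exists_ge_lt_iff (hY.continuous_paths _) hT] at hq
  simp only [exists_ge_lt_iff (hX.continuous_paths _) hT]
  exact hb (fun i => -farTime T i) (fun i => (farTime T i)⁻¹) hq n hn X hX

/-- Almost surely the paths of superposed sources grow sublinearly in the past. -/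
theorem ae_eventually_abs_le (hY : IsScaledSource P v 1 Y) (hv : RegularVariance v)
    (hv0 : v 0 = 0) (hg : SubquadraticGrowth v) {ε : ℝ} (hε : 0 < ε) {n : ℕ} (hn : 1 ≤ n)
    {X : ℝ → Ω → ℝ} (hX : IsScaledSource P v n X) :
    ∀ᵐ ω ∂P, ∃ T, 0 < T ∧ ∀ t, T ≤ t → |X (-t) ω| ≤ n * ε * t := by
  rw [ae_iff, ← nonpos_iff_eq_zero]
  have hn1 : (1 : ℝ) ≤ n := by exact_mod_cast hn
  have h1 : ∀ M : ℕ, P {ω | ¬∃ T, 0 < T ∧ ∀ t, T ≤ t → |X (-t) ω| ≤ n * ε * t}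
      ≤ ENNReal.ofReal (Real.exp (-(M : ℝ))) := by
    intro M
    obtain ⟨T, hT, hb⟩ := hY.exists_tail_bound hv hv0 hg hε M
    refine (measure_mono fun ω hω => ?_).trans ((hb n hn X hX).trans
      (ENNReal.ofReal_le_ofReal (Real.exp_le_exp.2 ?_)))
    · simp only [mem_ofPred_eq, not_exists, not_and, not_forall, not_le] at hω
      obtain ⟨t, ht, h2⟩ := hω T hT
      exact ⟨t, ht, h2⟩
    · have : (0 : ℝ) ≤ M := by positivity
      nlinarith
  have h2 : Tendsto (fun M : ℕ => ENNReal.ofReal (Real.exp (-(M : ℝ)))) atTop (𝓝 0) := by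
    rw [← ENNReal.ofReal_zero]
    exact ENNReal.tendsto_ofReal
      ((Real.tendsto_exp_neg_atTop_nhds_zero).comp tendsto_natCast_atTop_atTop)
  exact ge_of_tendsto' h2 h1

end IsScaledSource

end SupBounds

end Tandem

/-! ### Lower bounds for steep path events -/

namespace Tandem

/-- Lower bound for the upper tail of a Gaussian law. -/
lemma exp_le_gaussianReal_Ici {x : ℝ} (hx : 0 ≤ x) :
    ENNReal.ofReal (Real.exp (-(x ^ 2 + 2))) ≤ gaussianReal 0 1 (Ici x) := by
  -- Only [x, x + 1] is used, where (x + 1)²/2 ≤ x² + 1, together with √(2π) ≤ e.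
  have h1 : ∀ y ∈ Icc x (x + 1),
      ENNReal.ofReal (Real.exp (-(x ^ 2 + 2))) ≤ gaussianPDF 0 1 y := by
    intro y hy
    rw [gaussianPDF, gaussianPDFReal]
    refine ENNReal.ofReal_le_ofReal ?_
    have h2 : √(2 * Real.pi * ((1 : NNReal) : ℝ)) ≤ Real.exp 1 := by
      rw [Real.sqrt_le_left (Real.exp_pos 1).le]
      have := Real.pi_lt_d2
      have := Real.exp_one_gt_d9
      push_cast
      nlinarith
    have h3 : Real.exp (-1) ≤ (√(2 * Real.pi * ((1 : NNReal) : ℝ)))⁻¹ := by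
      rw [Real.exp_neg]
      exact inv_anti₀ (by positivity) h2
    rw [show -(x ^ 2 + 2) = -1 + -(x ^ 2 + 1) by ring, Real.exp_add]
    refine mul_le_mul h3 (Real.exp_le_exp.2 ?_) (Real.exp_pos _).le (by positivity)
    have h4 : y ^ 2 ≤ (x + 1) ^ 2 := pow_le_pow_left₀ (hx.trans hy.1) hy.2 2
    push_cast
    nlinarith [sq_nonneg (x - 1)]
  rw [gaussianReal_apply _ one_ne_zero]
  calc ENNReal.ofReal (Real.exp (-(x ^ 2 + 2)))
      = ∫⁻ _ in Icc x (x + 1), ENNReal.ofReal (Real.exp (-(x ^ 2 + 2))) := by simp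
    _ ≤ ∫⁻ y in Icc x (x + 1), gaussianPDF 0 1 y := setLIntegral_mono' measurableSet_Icc h1
    _ ≤ ∫⁻ y in Ici x, gaussianPDF 0 1 y := lintegral_mono_set Icc_subset_Ici_self

variable {Ω : Type*} [MeasurableSpace Ω] {P : Measure Ω} {v : ℝ → ℝ}

namespace IsScaledSource

variable {Y : ℝ → Ω → ℝ}

lemma exp_le_measure_ge (hY : IsScaledSource P v 1 Y) (hv0 : v 0 = 0) {t : ℝ} (ht : 0 < v |t|)
    {x : ℝ} (hx : 0 ≤ x) :
    ENNReal.ofReal (Real.exp (-(x ^ 2 + 2))) ≤ P {ω | x * √(v |t|) ≤ -Y t ω} := by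
  have hσ : 0 < √(v |t|) := Real.sqrt_pos.2 ht
  have hmap := (hY.gaussian.hasGaussianLaw_eval t).map_eq_gaussianReal
  rw [hY.centered, hY.variance_eq hv0, one_mul] at hmap
  have hm := (hY.memLp t).aemeasurable
  have h1 : Measure.map (fun ω => -(√(v |t|))⁻¹ * Y t ω) P = gaussianReal 0 1 := by
    have h2 : (fun ω => -(√(v |t|))⁻¹ * Y t ω) = (fun y => -(√(v |t|))⁻¹ * y) ∘ Y t := rfl
    rw [h2, ← AEMeasurable.map_map_of_aemeasurable (by fun_prop) hm, hmap,
      gaussianReal_map_const_mul, mul_zero]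
    congr 1
    ext
    push_cast
    rw [Real.coe_toNNReal _ ht.le, neg_sq, inv_pow, Real.sq_sqrt ht.le,
      inv_mul_cancel₀ ht.ne']
  refine (exp_le_gaussianReal_Ici hx).trans ?_
  rw [← h1, Measure.map_apply_of_aemeasurable (hm.const_mul _) measurableSet_Ici]
  refine measure_mono fun ω hω => ?_
  have hω' : x ≤ -(√(v |t|))⁻¹ * Y t ω := hω
  rw [neg_mul, ← mul_neg, inv_mul_eq_div, le_div_iff₀ hσ] at hω'
  exact hω'

variable [IsProbabilityMeasure P]

/-- The residual of the regression on the value at time `t` is independent of that value. -/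
lemma indepFun_residual (hY : IsScaledSource P v 1 Y) (hv0 : v 0 = 0) {t : ℝ} (ht : v |t| ≠ 0) :
    IndepFun (fun ω s => Y s ω - Gam v s t / v |t| * Y t ω) (Y t) P := by
  classical
  have hG : IsGaussianProcess (Sum.elim (fun s ω => Y s ω - Gam v s t / v |t| * Y t ω)
      (fun (_ : Unit) => Y t)) P := by
    refine hY.gaussian.of_isGaussianProcess fun i => ?_
    rcases i with s | -
    · exact ⟨{s, t}, ContinuousLinearMap.proj (R := ℝ) (φ := fun _ => ℝ) ⟨s, by simp⟩
        - (Gam v s t / v |t|) • ContinuousLinearMap.proj (R := ℝ) (φ := fun _ => ℝ) ⟨t, by simp⟩,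
        fun ω => by simp⟩
    · exact ⟨{t}, ContinuousLinearMap.proj (R := ℝ) (φ := fun _ => ℝ) ⟨t, by simp⟩,
        fun ω => by simp⟩
  have hm := fun s => (hY.memLp s).aemeasurable
  have h := hG.indepFun_of_covariance_eq_zero (fun s => (hm s).sub ((hm t).const_mul _))
    (fun _ => hm t) (fun s _ => ?_)
  · exact h.comp measurable_id (measurable_pi_apply ())
  · rw [covariance_fun_sub_left (hY.memLp s) ((hY.memLp t).const_mul _) (hY.memLp t),
      covariance_const_mul_left, hY.covariance_eq, hY.covariance_eq, Gam_self hv0]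
    field_simp
    ring

end IsScaledSource

/-- The variance of the bridge to time `t` is at least linear in the distance to `t`. -/
lemma RegularVariance.exists_mul_le_sub_Gam (hv : RegularVariance v) (hv0 : v 0 = 0) {τ T : ℝ}
    (hτ : 0 < τ) : ∃ c, 0 < c ∧ ∀ t ∈ Icc τ T, ∀ s ∈ Icc 0 t, c * (t - s) ≤ v t - Gam v s t := by
  obtain ⟨c, hc, h⟩ := hv.exists_mul_sub_le T
  refine ⟨c * √(v τ) / 2, by have := hv.sqrt_pos hτ; positivity, fun t ht s hs => ?_⟩
  have ht0 : 0 ≤ t := hs.1.trans hs.2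
  rw [Gam_of_le hs.1 hs.2]
  -- Twice v(t) - Γ(s, t) is at least v(t) - v(s) = (√v(t) - √v(s))(√v(t) + √v(s)).
  have h1 := h s t hs.1 hs.2 ht.2
  have h2 : √(v τ) ≤ √(v t) :=
    hv.strictMonoOn.monotoneOn (mem_Ici.2 hτ.le) (mem_Ici.2 ht0) ht.1
  have h3 := hv.nonneg hv0 (show 0 ≤ t - s by linarith [hs.2])
  have h4 := hv.sq_sqrt hv0 ht0
  have h5 := hv.sq_sqrt hv0 hs.1
  have h6 : c * (t - s) * √(v τ) ≤ (√(v t) - √(v s)) * (√(v t) + √(v s)) :=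
    mul_le_mul h1 (by linarith [Real.sqrt_nonneg (v s)]) (Real.sqrt_nonneg _)
      ((mul_nonneg hc.le (by linarith [hs.2])).trans h1)
  nlinarith

/-- The path events with slope `Λ` have at most exponentially small probability. -/
theorem IsIIDGaussianSources.exists_exp_le_pathProb [IsProbabilityMeasure P] {A : ℕ → ℝ → Ω → ℝ}
    (hA : IsIIDGaussianSources P v A) (hv : RegularVariance v) {Λ τ T : ℝ} (hΛ : 0 ≤ Λ)
    (hτ : 0 < τ) : ∃ K, 0 < K ∧ ∀ ρ : ℝ, 0 < ρ → ∃ m₀ : ℕ, ∀ m, m₀ ≤ m → ∀ t ∈ Icc τ T,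
      ENNReal.ofReal (Real.exp (-(m * K))) ≤ pathProb P A m t fun s => m * (Λ * (t - s) - ρ) := by
  have hv0 : v 0 = 0 := (hA.source 0).v_zero
  have hY := (hA.source 0).isScaledSource (hA.aemeasurable 0)
  set Y := A 0
  obtain ⟨c, hc, hw⟩ := hv.exists_mul_le_sub_Gam hv0 hτ (T := T)
  rcases lt_or_ge T τ with hTτ | hTτ
  · exact ⟨1, one_pos, fun ρ hρ => ⟨0, fun m _ t ht => absurd (ht.1.trans ht.2) (not_le.2 hTτ)⟩⟩
  have hT0 : 0 < T := hτ.trans_le hTτ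
  obtain ⟨a, ha, hq⟩ := hY.exists_bound_Icc_measure_le hT0.le
  set l := Λ / c with hl
  have hl0 : 0 ≤ l := by positivity
  have hvT := hv.pos hT0
  -- The 3 is 2 from the Gaussian tail plus 1 from the residual event. K must not depend on ρ: the
  -- discretization fixes its parameters from K before choosing ρ.
  refine ⟨l ^ 2 * v T + 3, by positivity, fun ρ hρ => ?_⟩
  obtain ⟨m₀, hm₀⟩ := exists_nat_gt ((2 * a / ρ) ^ 2)
  refine ⟨max 1 m₀, fun m hm t ht => ?_⟩
  have hm1 : 1 ≤ m := (le_max_left _ _).trans hm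
  have hmm : (m₀ : ℝ) ≤ m := by exact_mod_cast (le_max_right _ _).trans hm
  have hm1' : (1 : ℝ) ≤ m := by exact_mod_cast hm1
  have hm0 : (0 : ℝ) < m := by positivity
  have hsm : 2 * a ≤ √m * ρ := by
    rw [← div_le_iff₀ hρ]
    exact Real.le_sqrt_of_sq_le (hm₀.le.trans hmm)
  have ht0 : 0 < t := hτ.trans_le ht.1
  have hvt := hv.pos ht0
  have habs : |(-t)| = t := by rw [abs_neg, abs_of_pos ht0]
  have hX := hY.const_mul √m
  rw [Real.sq_sqrt hm0.le, mul_one] at hX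
  rw [hA.pathProb_eq hX]
  -- Y(-r) - Y(-t) is the residual at -r minus (1 - Γ(r, t)/v(t)) Y(-t). A very negative Y(-t)
  -- forces the slope, while the independent residual only has to stay above -√m ρ.
  have hind := hY.indepFun_residual hv0 (t := -t) (by rw [habs]; exact hvt.ne')
  rw [habs] at hind
  set S : Set (ℝ → ℝ) := {x | ∀ r : ℚ, 0 ≤ (r : ℝ) → (r : ℝ) ≤ t → -(√m * ρ) ≤ x (-r)} with hS
  have hSm : MeasurableSet S := by
    have h : S = ⋂ r : ℚ, {x | 0 ≤ (r : ℝ) → (r : ℝ) ≤ t → -(√m * ρ) ≤ x (-r)} := by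
      ext x
      simp [hS]
    rw [h]
    refine MeasurableSet.iInter fun r => ?_
    by_cases h0 : 0 ≤ (r : ℝ) <;> by_cases h1 : (r : ℝ) ≤ t
    · simp only [h0, h1, true_implies]
      exact measurableSet_le measurable_const (by fun_prop)
    all_goals simp [h0, h1]
  set x := √m * l * √(v t) with hx
  have hprod := hind.measure_inter_preimage_eq_mul _ _ hSm
    (measurableSet_Iic (a := -(x * √(v t))))
  have hx2 : x ^ 2 ≤ m * (l ^ 2 * v T) := by
    rw [hx, mul_pow, mul_pow, Real.sq_sqrt hm0.le, Real.sq_sqrt hvt.le, mul_assoc]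
    gcongr
    exact hv.le_of_le ht0.le ht.2
  have hP2 : ENNReal.ofReal (Real.exp (-(m * (l ^ 2 * v T + 2))))
      ≤ P (Y (-t) ⁻¹' Iic (-(x * √(v t)))) := by
    have h := hY.exp_le_measure_ge hv0 (t := -t) (by rwa [habs]) (show 0 ≤ x by positivity)
    rw [habs] at h
    refine (ENNReal.ofReal_le_ofReal (Real.exp_le_exp.2 ?_)).trans (h.trans ?_)
    · nlinarith
    · refine measure_mono fun ω hω => ?_
      have hω' : x * √(v t) ≤ -Y (-t) ω := hω
      exact le_neg.1 hω'
  have hP1 : ENNReal.ofReal (Real.exp (-1))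
      ≤ P ((fun ω s => Y s ω - Gam v s (-t) / v t * Y (-t) ω) ⁻¹' S) := by
    have hsub : {ω | ∃ u ∈ Icc (-T) T, a < |Y u ω|}ᶜ
        ⊆ (fun ω s => Y s ω - Gam v s (-t) / v t * Y (-t) ω) ⁻¹' S := by
      rintro ω hω r hr0 hrt
      have hω' : ∀ u ∈ Icc (-T) T, |Y u ω| ≤ a := by
        intro u hu
        by_contra hcon
        exact hω ⟨u, hu, not_le.1 hcon⟩
      have hT := ht.2
      have h1 := hω' (-r) ⟨by linarith, by linarith⟩
      have h2 := hω' (-t) ⟨by linarith, by linarith⟩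
      have h3 : |Gam v (-r) (-t) / v t| ≤ 1 := by
        rw [Gam_neg_neg, Gam_of_le hr0 hrt, abs_div, abs_of_pos hvt, div_le_one hvt, abs_le]
        have h4 := hv.nonneg hv0 hr0
        have h5 := hv.le_of_le hr0 hrt
        have h6 := hv.le_of_le (show 0 ≤ t - r by linarith) (show t - r ≤ t by linarith)
        have h7 := hv.nonneg hv0 (show 0 ≤ t - r by linarith)
        constructor <;> linarith
      have h8 : |Gam v (-r) (-t) / v t * Y (-t) ω| ≤ a := by
        rw [abs_mul]
        nlinarith [abs_nonneg (Y (-t) ω)]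
      have h9 := (abs_le.1 h1).1
      have h10 := (abs_le.1 h8).2
      linarith
    have hnull : NullMeasurableSet {ω | ∃ u ∈ Icc (-T) T, a < |Y u ω|} P := by
      simp only [exists_Icc_lt_iff (hY.continuous_paths _) hT0.le]
      simpa using hY.nullMeasurableSet_exists_lt (clampTime T) (fun _ => 1) a
    refine le_trans ?_ (measure_mono hsub)
    rw [prob_compl_eq_one_sub₀ hnull]
    refine ENNReal.le_sub_of_add_le_left (measure_ne_top _ _) ?_
    refine (add_le_add_left hq _).trans ?_
    have h1 : Real.exp (-1) ≤ 3 / 4 := by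
      rw [Real.exp_neg, inv_le_comm₀ (Real.exp_pos 1) (by norm_num)]
      have := Real.exp_one_gt_d9
      linarith
    calc (1 / 4 : ENNReal) + ENNReal.ofReal (Real.exp (-1))
        = ENNReal.ofReal (1 / 4) + ENNReal.ofReal (Real.exp (-1)) := by
          rw [ENNReal.ofReal_div_of_pos (by norm_num)]
          simp
      _ = ENNReal.ofReal (1 / 4 + Real.exp (-1)) :=
          (ENNReal.ofReal_add (by norm_num) (Real.exp_pos _).le).symm
      _ ≤ 1 := ENNReal.ofReal_le_one.2 (by linarith)
  calc ENNReal.ofReal (Real.exp (-(m * (l ^ 2 * v T + 3))))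
      ≤ ENNReal.ofReal (Real.exp (-1)) * ENNReal.ofReal (Real.exp (-(m * (l ^ 2 * v T + 2)))) := by
        rw [← ENNReal.ofReal_mul (Real.exp_pos _).le, ← Real.exp_add]
        refine ENNReal.ofReal_le_ofReal (Real.exp_le_exp.2 ?_)
        linarith
    _ ≤ _ := mul_le_mul' hP1 hP2
    _ = _ := hprod.symm
    _ ≤ _ := by
      refine measure_mono ?_
      rintro ω ⟨h1, h2⟩ r hr0 hrt
      have h3 := h1 r hr0 hrt
      have h4 : Y (-t) ω ≤ -(x * √(v t)) := h2
      simp only [Gam_neg_neg] at h3 ⊢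
      have h5 := hw t ht r ⟨hr0, hrt⟩
      have h6 : x * √(v t) = √m * l * v t := by
        rw [hx, mul_assoc, Real.mul_self_sqrt hvt.le]
      have h7 : 0 ≤ 1 - Gam v r t / v t := by
        rw [sub_nonneg, div_le_one hvt]
        nlinarith
      have h8 := mul_le_mul_of_nonneg_left h4 h7
      have h9 : (1 - Gam v r t / v t) * (x * √(v t)) = √m * l * (v t - Gam v r t) := by
        rw [h6]
        field_simp
      have h10 : √m * (Λ * (t - r)) ≤ √m * l * (v t - Gam v r t) := by
        rw [mul_assoc]
        refine mul_le_mul_of_nonneg_left ?_ (Real.sqrt_nonneg _)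
        calc Λ * (t - r) = l * (c * (t - r)) := by
              rw [hl]
              field_simp
          _ ≤ _ := mul_le_mul_of_nonneg_left h5 hl0
      have h11 : √m * (Λ * (t - r)) - √m * ρ ≤ Y (-r) ω - Y (-t) ω := by linarith
      have h12 := mul_le_mul_of_nonneg_left h11 (Real.sqrt_nonneg m)
      have h13 : √m * (√m * (Λ * (t - r)) - √m * ρ) = m * (Λ * (t - r) - ρ) := by
        nth_rewrite 4 [← Real.mul_self_sqrt hm0.le]
        ring
      linarith

end Tandem

/-! ### From path events to overflow probabilities -/

namespace Tandem

variable {Ω : Type*} [MeasurableSpace Ω] {P : Measure Ω} [IsProbabilityMeasure P] {v : ℝ → ℝ}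
  {A : ℕ → ℝ → Ω → ℝ} {b c₁ c₂ : ℝ}

namespace IsIIDGaussianSources

/-- Guarantees that the suprema defining `Q2` are almost surely genuine. -/
lemma ae_bddAbove (hA : IsIIDGaussianSources P v A) (hv : RegularVariance v)
    (hg : SubquadraticGrowth v) (hc₂ : 0 < c₂) {n : ℕ} (hn : 1 ≤ n) :
    ∀ᵐ ω ∂P, BddAbove (range fun s : Ici (0 : ℝ) =>
      -(∑ i ∈ Finset.range n, A i (-s) ω) - n * c₂ * s) := by
  have hX := hA.isScaledSource_range n
  filter_upwards [((hA.source 0).isScaledSource (hA.aemeasurable 0)).ae_eventually_abs_le hv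
    (hA.source 0).v_zero hg hc₂ hn hX] with ω ⟨T, hT, h⟩
  obtain ⟨C, hC⟩ := (isCompact_Icc (a := -T) (b := 0)).exists_bound_of_continuousOn
    (hX.continuous_paths ω).continuousOn
  have hC0 : 0 ≤ C := (norm_nonneg _).trans (hC 0 ⟨by linarith, le_rfl⟩)
  refine ⟨C, ?_⟩
  rintro _ ⟨⟨s, hs⟩, rfl⟩
  have hs' : 0 ≤ s := hs
  simp only
  rcases le_total T s with hTs | hTs
  · have h1 := neg_abs_le (∑ i ∈ Finset.range n, A i (-s) ω)
    have h2 := h s hTs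
    linarith
  · have h1 := hC (-s) ⟨by linarith, by linarith⟩
    rw [Real.norm_eq_abs] at h1
    have h2 := neg_abs_le (∑ i ∈ Finset.range n, A i (-s) ω)
    have h3 : 0 ≤ n * c₂ * s := by positivity
    linarith

/-- Each path event with some slack forces the second queue to exceed `n b`. -/
lemma pathProb_le_measure_Q2 (hA : IsIIDGaussianSources P v A) (hv : RegularVariance v)
    (hg : SubquadraticGrowth v) (hc₂ : 0 < c₂) (hc : c₂ < c₁) {n : ℕ} (hn : 1 ≤ n) {t η : ℝ}
    (ht : 0 < t) (hη : 0 < η) :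
    pathProb P A n t (fun s => n * (b + c₂ * t - c₁ * s + η)) ≤ P {ω | n * b < Q2 A c₁ c₂ n ω} := by
  have hX := hA.isScaledSource_range n
  have hn0 : (0 : ℝ) < n := by positivity
  refine measure_mono_ae ?_
  filter_upwards [hA.ae_bddAbove hv hg hc₂ hn] with ω hbdd hω
  refine lt_secondQueue_of_forall_le (η := n * η) (hX.start_zero ω)
    (mul_le_mul_of_nonneg_left hc.le hn0.le) hbdd ht.le (by positivity) fun s hs => ?_
  have h := le_of_mem_pathEvent ht (by fun_prop) (hX.continuous_paths ω) hω hs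
  linarith

/-- If the second queue exceeds `n b`, then some path event occurs. -/
lemma ae_exists_of_lt_Q2 (hA : IsIIDGaussianSources P v A) (hv : RegularVariance v)
    (hg : SubquadraticGrowth v) (hc₂ : 0 < c₂) (hc : c₂ < c₁) {n : ℕ} (hn : 1 ≤ n) :
    ∀ᵐ ω ∂P, n * b < Q2 A c₁ c₂ n ω → ∃ t, 0 ≤ t ∧ ∀ s, 0 ≤ s → n * (b + c₂ * t - c₁ * s)
      < ∑ i ∈ Finset.range n, A i (-s) ω - ∑ i ∈ Finset.range n, A i (-t) ω := by
  have hX := hA.isScaledSource_range n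
  filter_upwards [hA.ae_bddAbove hv hg hc₂ hn] with ω hbdd hω
  obtain ⟨t, ht, h⟩ := exists_forall_lt_of_lt_secondQueue (hX.start_zero ω)
    (mul_le_mul_of_nonneg_left hc.le (Nat.cast_nonneg n)) hbdd hω
  exact ⟨t, ht, fun s hs => by linarith [h s hs]⟩

/-- For every admissible time the path events have at most exponentially small probability. -/
lemma exists_exp_le_pathProb_queue (hA : IsIIDGaussianSources P v A) (hv : RegularVariance v)
    (hb : 0 < b) (hc₂ : 0 < c₂) (hc : c₂ < c₁) {t η : ℝ} (ht : b / (c₁ - c₂) < t)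
    (hη : η < (c₁ - c₂) * (t - b / (c₁ - c₂))) :
    ∃ K, 0 < K ∧ ∃ m₀ : ℕ, ∀ m, m₀ ≤ m → ENNReal.ofReal (Real.exp (-(m * K)))
      ≤ pathProb P A m t (fun s => m * (b + c₂ * t - c₁ * s + η)) := by
  have hd : 0 < c₁ - c₂ := sub_pos.2 hc
  have ht0 : 0 < t := (by positivity : 0 < b / (c₁ - c₂)).trans ht
  -- The barrier b + c₂t - c₁s + η equals c₁(t - s) - ρ, where ρ = (c₁ - c₂)(t - t₀) - η is
  -- positive.
  obtain ⟨K, hK, h⟩ := hA.exists_exp_le_pathProb hv (Λ := c₁) (by linarith) ht0 (T := t)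
  obtain ⟨m₀, hm⟩ := h _ (sub_pos.2 hη)
  refine ⟨K, hK, m₀, fun m hmm => (hm m hmm t ⟨le_rfl, le_rfl⟩).trans (pathProb_anti ?_)⟩
  intro s _
  refine mul_le_mul_of_nonneg_left ?_ (Nat.cast_nonneg m)
  rw [mul_sub (c₁ - c₂), mul_div_cancel₀ _ hd.ne']
  linarith

lemma pathProb_pow_mul_le (hA : IsIIDGaussianSources P v A) (N r j : ℕ) {t : ℝ} {φ : ℝ → ℝ} :
    pathProb P A N t (fun s => N * φ s) ^ j * pathProb P A r t (fun s => r * φ s)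
      ≤ pathProb P A (N * j + r) t (fun s => (N * j + r : ℕ) * φ s) := by
  induction j with
  | zero => simp
  | succ j ih =>
    rw [pow_succ', mul_assoc]
    refine (mul_le_mul_right ih _).trans ((hA.pathProb_mul_le N (N * j + r)
      (χ := fun s => (N * (j + 1) + r : ℕ) * φ s) fun s _ => ?_).trans_eq ?_)
    · push_cast
      linarith
    · congr 1
      ring

/-- A lower bound for one path event gives a lower bound for the overflow probabilities. -/
theorem eventually_exp_le_measure_Q2 (hA : IsIIDGaussianSources P v A) (hv : RegularVariance v)
    (hg : SubquadraticGrowth v) (hb : 0 < b) (hc₂ : 0 < c₂) (hc : c₂ < c₁) {t η : ℝ}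
    (ht : b / (c₁ - c₂) < t) (hη0 : 0 < η) (hη : η < (c₁ - c₂) * (t - b / (c₁ - c₂))) {N : ℕ}
    (hN : 1 ≤ N) {R R' : ℝ} (hR : 0 ≤ R) (hRR' : R < R')
    (h : ENNReal.ofReal (Real.exp (-(N * R)))
      ≤ pathProb P A N t (fun s => N * (b + c₂ * t - c₁ * s + η))) :
    ∀ᶠ n : ℕ in atTop, ENNReal.ofReal (Real.exp (-(n * R'))) ≤ P {ω | n * b < Q2 A c₁ c₂ n ω} := by
  have hd : 0 < c₁ - c₂ := sub_pos.2 hc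
  have ht0 : 0 < t := (by positivity : 0 < b / (c₁ - c₂)).trans ht
  obtain ⟨K, hK, m₀, hm⟩ := hA.exists_exp_le_pathProb_queue hv hb hc₂ hc ht hη
  have hlim : ∀ᶠ n : ℕ in atTop, ((m₀ + N : ℕ) : ℝ) * K ≤ n * (R' - R) :=
    (tendsto_natCast_atTop_atTop.atTop_mul_const (sub_pos.2 hRR')).eventually_ge_atTop _
  filter_upwards [hlim, eventually_ge_atTop (m₀ + 1)] with n hn1 hn2
  refine le_trans ?_ (hA.pathProb_le_measure_Q2 hv hg hc₂ hc (by omega) ht0 hη0)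
  set j := (n - m₀) / N
  -- The remainder lies between m₀, so that the steep-path bound applies, and m₀ + N, so that its
  -- cost is bounded and disappears in R' - R.
  set r := m₀ + (n - m₀) % N with hr
  have hnj : n = N * j + r := by
    have : N * j + (n - m₀) % N = n - m₀ := Nat.div_add_mod (n - m₀) N
    omega
  have hrlt : r ≤ m₀ + N := by
    have := Nat.mod_lt (n - m₀) (show 0 < N by omega)
    omega
  have hpow := hA.pathProb_pow_mul_le N r j (t := t) (φ := fun s => b + c₂ * t - c₁ * s + η)
  rw [← hnj] at hpow
  refine le_trans ?_ hpow
  refine le_trans ?_ (mul_le_mul' (pow_le_pow_left₀ zero_le h j) (hm r (by omega)))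
  rw [← ENNReal.ofReal_pow (Real.exp_pos _).le, ← Real.exp_nat_mul,
    ← ENNReal.ofReal_mul (Real.exp_pos _).le, ← Real.exp_add]
  refine ENNReal.ofReal_le_ofReal (Real.exp_le_exp.2 ?_)
  have hnj' : (n : ℝ) = N * j + r := by exact_mod_cast hnj
  have hr' : (r : ℝ) ≤ (m₀ + N : ℕ) := by exact_mod_cast hrlt
  have h1 : (r : ℝ) * K ≤ (m₀ + N : ℕ) * K := mul_le_mul_of_nonneg_right hr' hK.le
  have h2 : 0 ≤ (r : ℝ) * R := by positivity
  have h3 : (n : ℝ) * R = N * j * R + r * R := by rw [hnj']; ring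
  nlinarith

end IsIIDGaussianSources

end Tandem

/-! ### From overflow probabilities back to one path event -/

namespace Tandem

variable {Ω : Type*} [MeasurableSpace Ω] {P : Measure Ω} [IsProbabilityMeasure P] {v : ℝ → ℝ}
  {A : ℕ → ℝ → Ω → ℝ} {b c₁ c₂ : ℝ}

namespace IsIIDGaussianSources

open Classical in
/-- Up to large increments over short intervals, an overflow that originates during
`[τ, τ + h']` implies a path event for the input shifted by `h`, with a surplus after time `h`
and a small deficit before. -/
lemma measure_exists_Icc_le (hA : IsIIDGaussianSources P v A) (hc₁ : 0 < c₁) (hc₂ : 0 < c₂)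
    (n : ℕ) {τ h h' ε κ : ℝ} (hh : 0 < h) (hh' : 0 < h') :
    P {ω | ∃ t ∈ Icc τ (τ + h'), ∀ s, 0 ≤ s → n * (b + c₂ * t - c₁ * s)
        < ∑ i ∈ Finset.range n, A i (-s) ω - ∑ i ∈ Finset.range n, A i (-t) ω}
      ≤ P {ω | ∃ u ∈ Icc (-h') h', n * ε < |∑ i ∈ Finset.range n, A i (-τ + u) ω
            - ∑ i ∈ Finset.range n, A i (-τ) ω|}
        + P {ω | ∃ u ∈ Icc (-h) h, n * κ < |∑ i ∈ Finset.range n, A i (0 + u) ω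
            - ∑ i ∈ Finset.range n, A i 0 ω|}
        + pathProb P A n (τ + h) (fun s => n * (b + c₂ * (τ + h) - c₁ * s
            + if h ≤ s then (c₁ - c₂) * h - ε else -(c₂ * h + ε + κ))) := by
  have hX := hA.isScaledSource_range n
  -- The shift turns the constraint at q - h into one at q for horizon τ + h, gaining (c₁ - c₂)h.
  -- For q < h only the constraint at 0 and the small increments near 0 are available, hence a
  -- deficit.
  have hX' := hX.shift (hA.source 0).v_zero h
  rw [hA.pathProb_eq hX']
  refine le_trans (measure_mono ?_) ((measure_union_le _ _).trans
    (add_le_add_left (measure_union_le _ _) _))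
  rintro ω ⟨t, ht, hω⟩
  by_contra hcon
  rw [mem_union, mem_union, not_or, not_or] at hcon
  obtain ⟨⟨h1, h2⟩, h3⟩ := hcon
  simp only [mem_ofPred_eq, not_exists, not_and, not_lt] at h1 h2
  refine h3 fun q hq0 hqt => ?_
  have hn : (0 : ℝ) ≤ n := Nat.cast_nonneg n
  have h4 := h1 (τ - t) ⟨by linarith [ht.2], by linarith [ht.1]⟩
  rw [show -τ + (τ - t) = -t by ring] at h4
  have h5 := (abs_le.1 h4).1
  have h6 : (n : ℝ) * (c₂ * τ) ≤ n * (c₂ * t) := by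
    gcongr
    exact ht.1
  simp only [show h + -(τ + h) = -τ by ring]
  split_ifs with hhq
  · have h7 := hω (q - h) (by linarith)
    rw [show -((q : ℝ) - h) = h + -q by ring] at h7
    linarith
  · have h7 := hω 0 le_rfl
    have h8 := h2 (h + -q) ⟨by linarith, by linarith⟩
    rw [zero_add] at h8
    rw [neg_zero] at h7
    have h9 := (abs_le.1 h8).1
    have h10 : 0 ≤ (n : ℝ) * (c₁ * q) := by positivity
    linarith

open Classical in
/-- Adding a few sources that follow a steep path turns the surplus into a uniform one. -/
lemma pathProb_mul_le_of_deficit (hA : IsIIDGaussianSources P v A) (hc : c₂ < c₁)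
    {n m : ℕ} {t₀ t h δ ε κ η ρ : ℝ} (ht₀ : t₀ = b / (c₁ - c₂)) (ht₀_pos : 0 < t₀)
    (ht : t₀ + h ≤ t) (hh : 0 ≤ h) (hmn : m ≤ n) (hδ : δ * n ≤ m) (hη : 0 ≤ η) (hρ : 0 ≤ ρ)
    (hρ1 : ρ ≤ 1) (hlate : 2 * η + ρ + ε ≤ (c₁ - c₂) * h)
    (hearly : 2 * η + c₂ * h + ε + κ ≤ δ) :
    pathProb P A n t (fun s => n * (b + c₂ * t - c₁ * s
        + if h ≤ s then (c₁ - c₂) * h - ε else -(c₂ * h + ε + κ)))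
      * pathProb P A m t (fun s => m * ((c₁ + 2 / t₀) * (t - s) - ρ))
      ≤ pathProb P A (n + m) t (fun s => (n + m : ℕ) * (b + c₂ * t - c₁ * s + η)) := by
  refine hA.pathProb_mul_le n m fun s hs => ?_
  have hd : 0 < c₁ - c₂ := sub_pos.2 hc
  have hb : b = (c₁ - c₂) * t₀ := by rw [ht₀, mul_div_cancel₀ _ hd.ne']
  have hmn' : (m : ℝ) ≤ n := by exact_mod_cast hmn
  have hm0 : (0 : ℝ) ≤ m := Nat.cast_nonneg m
  have hn0 : (0 : ℝ) ≤ n := Nat.cast_nonneg n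
  -- As t ≥ t₀, slope c₁ already pays the extra sources' own share. For s < h one has t - s ≥ t₀, so
  -- the additional slope 2/t₀ yields 2m; after losing ρ ≤ 1 per source, m ≥ δn remains against the
  -- deficit.
  have h1 : b + c₂ * t - c₁ * s ≤ c₁ * (t - s) := by
    have := mul_le_mul_of_nonneg_left (show t₀ ≤ t by linarith) hd.le
    rw [hb]
    linarith
  have h2 := mul_le_mul_of_nonneg_left h1 hm0
  have h3 : (m : ℝ) * η ≤ n * η := mul_le_mul_of_nonneg_right hmn' hη
  push_cast
  split_ifs with hhs
  · have h4 : 0 ≤ (m : ℝ) * (2 / t₀ * (t - s)) := by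
      have := sub_nonneg.2 hs.2
      positivity
    have h5 : (m : ℝ) * ρ ≤ n * ρ := mul_le_mul_of_nonneg_right hmn' hρ
    have h6 := mul_le_mul_of_nonneg_left hlate hn0
    linarith
  · have h4 : (m : ℝ) * 2 ≤ m * (2 / t₀ * (t - s)) := by
      refine mul_le_mul_of_nonneg_left ?_ hm0
      rw [div_mul_eq_mul_div, le_div_iff₀ ht₀_pos]
      linarith [not_le.1 hhs]
    have h5 : (m : ℝ) * ρ ≤ m * 1 := mul_le_mul_of_nonneg_left hρ1 hm0
    have h6 := mul_le_mul_of_nonneg_left hearly hn0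
    linarith

/-- The overflow probability is at most the sum of the probabilities over a time grid, plus that
of a large value far in the past. -/
lemma measure_Q2_le_sum (hA : IsIIDGaussianSources P v A) (hv : RegularVariance v)
    (hg : SubquadraticGrowth v) (hb : 0 < b) (hc₂ : 0 < c₂) (hc : c₂ < c₁) {n : ℕ} (hn : 1 ≤ n)
    {T h : ℝ} (hh : 0 < h) {L : ℕ} (hL : ⌊(T - b / (c₁ - c₂)) / h⌋₊ ≤ L) :
    P {ω | n * b < Q2 A c₁ c₂ n ω}
      ≤ P {ω | ∃ t, T ≤ t ∧ n * c₂ * t < |∑ i ∈ Finset.range n, A i (-t) ω|}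
        + ∑ k ∈ Finset.range (L + 1), P {ω | ∃ t ∈ Icc (b / (c₁ - c₂) + k * h)
            (b / (c₁ - c₂) + k * h + h), ∀ s, 0 ≤ s → n * (b + c₂ * t - c₁ * s)
        < ∑ i ∈ Finset.range n, A i (-s) ω - ∑ i ∈ Finset.range n, A i (-t) ω} := by
  have hX := hA.isScaledSource_range n
  have hn0 : (0 : ℝ) < n := by positivity
  have hd : 0 < c₁ - c₂ := sub_pos.2 hc
  refine le_trans ?_ ((measure_union_le _ _).trans
    (add_le_add_right (measure_biUnion_finset_le (Finset.range (L + 1)) _) _))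
  refine measure_mono_ae ?_
  filter_upwards [hA.ae_exists_of_lt_Q2 (b := b) hv hg hc₂ hc hn] with ω hω hQ
  obtain ⟨t, ht0, ht⟩ := hω hQ
  rcases le_total T t with hTt | hTt
  · refine Or.inl ⟨t, hTt, ?_⟩
    have h1 := ht 0 le_rfl
    simp only [neg_zero, hX.start_zero, mul_zero, sub_zero, zero_sub] at h1
    have h2 := neg_abs_le (∑ i ∈ Finset.range n, A i (-t) ω)
    have h3 : 0 < (n : ℝ) * b := by positivity
    linarith
  · right
    -- The constraint at s = t reads b + c₂t < c₁t, so overflow originates no later than t₀ before 0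
    -- and the grid may start at t₀.
    have h1 := ht t ht0
    rw [sub_self] at h1
    have h2 : b + c₂ * t - c₁ * t < 0 := by
      by_contra hcon
      exact absurd h1 (not_lt.2 (mul_nonneg hn0.le (not_lt.1 hcon)))
    have h3 : b / (c₁ - c₂) ≤ t := by
      rw [div_le_iff₀ hd]
      linarith
    have h4 : 0 ≤ (t - b / (c₁ - c₂)) / h := div_nonneg (by linarith) hh.le
    refine mem_iUnion₂.2 ⟨⌊(t - b / (c₁ - c₂)) / h⌋₊, ?_, t, ⟨?_, ?_⟩, ht⟩
    · rw [Finset.mem_range, Nat.lt_succ_iff]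
      refine le_trans (Nat.floor_le_floor ?_) hL
      gcongr
    · have h5 := Nat.floor_le h4
      rw [le_div_iff₀ hh] at h5
      linarith
    · have h5 := (Nat.lt_floor_add_one ((t - b / (c₁ - c₂)) / h)).le
      rw [div_le_iff₀ hh] at h5
      linarith

/-- Overflow probabilities that are not too small come from a single path event. -/
theorem exists_exp_le_pathProb_of_frequently (hA : IsIIDGaussianSources P v A)
    (hv : RegularVariance v) (hg : SubquadraticGrowth v) (hb : 0 < b) (hc₂ : 0 < c₂) (hc : c₂ < c₁)
    {R ε : ℝ} (hR : 0 ≤ R) (hε : 0 < ε)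
    (hfreq : ∃ᶠ n : ℕ in atTop, ENNReal.ofReal (Real.exp (-(n * R)))
      ≤ P {ω | n * b < Q2 A c₁ c₂ n ω}) :
    ∃ t η, b / (c₁ - c₂) < t ∧ 0 < η ∧ η < (c₁ - c₂) * (t - b / (c₁ - c₂)) ∧ ∃ N : ℕ, 1 ≤ N ∧
      ENNReal.ofReal (Real.exp (-(N * (R + ε))))
        ≤ pathProb P A N t (fun s => N * (b + c₂ * t - c₁ * s + η)) := by
  have hv0 : v 0 = 0 := (hA.source 0).v_zero
  have hY := (hA.source 0).isScaledSource (hA.aemeasurable 0)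
  have hd : 0 < c₁ - c₂ := sub_pos.2 hc
  have hc₁ : 0 < c₁ := hc₂.trans hc
  set t₀ := b / (c₁ - c₂) with ht₀
  have ht₀_pos : 0 < t₀ := by positivity
  obtain ⟨T₁, -, htail⟩ := hY.exists_tail_bound hv hv0 hg hc₂ (R + ε)
  set T := max T₁ t₀
  have hTt₀ : t₀ ≤ T := le_max_right _ _
  obtain ⟨K, hK, hsteep⟩ := hA.exists_exp_le_pathProb hv (Λ := c₁ + 2 / t₀) (τ := t₀)
    (T := T + 1) (by positivity) ht₀_pos
  -- The proportion of extra sources: their cost δnK stays below nε/2.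
  set δ := min 1 (ε / (2 * K)) with hδ
  have hδ0 : 0 < δ := by positivity
  obtain ⟨h₁, hh₁, hmod⟩ := hY.exists_modulus_bound hv0 (show 0 < δ / 4 by positivity) (R + ε)
  set h := min h₁ (min 1 (δ / (4 * c₂))) with hh_def
  have hh : 0 < h := by positivity
  have hhh₁ : h ≤ h₁ := min_le_left _ _
  have hh1 : h ≤ 1 := (min_le_right _ _).trans (min_le_left _ _)
  have hhδ : c₂ * h ≤ δ / 4 := by
    have h1 : h ≤ δ / (4 * c₂) := (min_le_right _ _).trans (min_le_right _ _)
    rw [le_div_iff₀ (by positivity)] at h1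
    linarith
  -- With η and ρ below, the early losses 2η, c₂h, ε' and κ = δ/4 are at most δ/4 each, and the late
  -- losses 2η, ρ, ε' take at most 1/4, 1/4, 1/2 of (c₁ - c₂)h.
  set ε' := min (δ / 4) ((c₁ - c₂) * h / 2) with hε'_def
  have hε' : 0 < ε' := by positivity
  obtain ⟨h', hh', hmod'⟩ := hY.exists_modulus_bound hv0 hε' (R + ε)
  set η := min (δ / 8) ((c₁ - c₂) * h / 8) with hη_def
  have hη : 0 < η := by positivity
  set ρ := min 1 ((c₁ - c₂) * h / 4) with hρ_def
  have hρ : 0 < ρ := by positivity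
  have hdh : 0 < (c₁ - c₂) * h := by positivity
  have hε1 : ε' ≤ δ / 4 := min_le_left _ _
  have hε2 : ε' ≤ (c₁ - c₂) * h / 2 := min_le_right _ _
  have hη1 : η ≤ δ / 8 := min_le_left _ _
  have hη2 : η ≤ (c₁ - c₂) * h / 8 := min_le_right _ _
  have hρ1 : ρ ≤ 1 := min_le_left _ _
  have hρ2 : ρ ≤ (c₁ - c₂) * h / 4 := min_le_right _ _
  obtain ⟨m₀, hm₀⟩ := hsteep ρ hρ
  set L := ⌊(T - t₀) / h'⌋₊ with hL
  have hδK : δ * K ≤ ε / 2 := by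
    have h1 : δ ≤ ε / (2 * K) := min_le_right _ _
    rw [le_div_iff₀ (by positivity)] at h1
    linarith
  have hlim1 : ∀ᶠ n : ℕ in atTop, (m₀ : ℝ) ≤ n * δ :=
    (tendsto_natCast_atTop_atTop.atTop_mul_const hδ0).eventually_ge_atTop _
  -- The number of error terms does not depend on n, so exp(nε/2) beats it; exp K accounts for
  -- rounding δn up to m.
  have hlim2 : ∀ᶠ n : ℕ in atTop,
      (1 + (L + 1) * 3 : ℕ) * Real.exp K < Real.exp (n * (ε / 2)) :=
    (Real.tendsto_exp_atTop.comp
      (tendsto_natCast_atTop_atTop.atTop_mul_const (half_pos hε))).eventually_gt_atTop _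
  obtain ⟨n, hnR, hn1, hn2, hn⟩ := (hfreq.and_eventually
    (hlim1.and (hlim2.and (eventually_ge_atTop 1)))).exists
  set m := ⌈δ * n⌉₊ with hm
  have hδm : δ * n ≤ m := Nat.le_ceil _
  have hmδ : (m : ℝ) < δ * n + 1 := Nat.ceil_lt_add_one (by positivity)
  have hmn : m ≤ n := by
    refine Nat.ceil_le.2 ?_
    have h1 : δ ≤ 1 := min_le_left _ _
    have h2 : (0 : ℝ) ≤ n := Nat.cast_nonneg n
    nlinarith
  have hm₀m : m₀ ≤ m := by
    have h1 : (m₀ : ℝ) ≤ m := by linarith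
    exact_mod_cast h1
  have hX := hA.isScaledSource_range n
  have hgrid : ∀ k ∈ Finset.range (L + 1), (k : ℝ) * h' ≤ T - t₀ := by
    intro k hk
    rw [Finset.mem_range, Nat.lt_succ_iff] at hk
    have h1 : (k : ℝ) ≤ L := by exact_mod_cast hk
    have h2 := Nat.floor_le (div_nonneg (sub_nonneg.2 hTt₀) hh'.le)
    rw [← le_div_iff₀ hh']
    exact h1.trans h2
  by_contra! hcon
  set D := ENNReal.ofReal (Real.exp (-(n * (R + ε)))) with hD
  have hcell : ∀ k ∈ Finset.range (L + 1), P {ω | ∃ t ∈ Icc (t₀ + k * h') (t₀ + k * h' + h'),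
      ∀ s, 0 ≤ s → n * (b + c₂ * t - c₁ * s)
        < ∑ i ∈ Finset.range n, A i (-s) ω - ∑ i ∈ Finset.range n, A i (-t) ω}
      * ENNReal.ofReal (Real.exp (-(m * K))) ≤ 3 * D := by
    intro k hk
    have hk' := hgrid k hk
    have hk0 : 0 ≤ (k : ℝ) * h' := by positivity
    refine (mul_le_mul_left (hA.measure_exists_Icc_le hc₁ hc₂ n (ε := ε') (κ := δ / 4) hh hh')
      _).trans ?_
    rw [add_mul, add_mul]
    have hexp : ENNReal.ofReal (Real.exp (-(m * K))) ≤ 1 :=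
      ENNReal.ofReal_le_one.2 (Real.exp_le_one_iff.2 (neg_nonpos.2 (by positivity)))
    have hA1 := (mul_le_of_le_one_right' hexp).trans (hmod' n hn _ hX (-(t₀ + k * h')))
    have hA2 := (mul_le_of_le_one_right' hexp).trans ((measure_mono (show
        {ω | ∃ u ∈ Icc (-h) h, n * (δ / 4) < |∑ i ∈ Finset.range n, A i (0 + u) ω
            - ∑ i ∈ Finset.range n, A i 0 ω|} ⊆
        {ω | ∃ u ∈ Icc (-h₁) h₁, n * (δ / 4) < |∑ i ∈ Finset.range n, A i (0 + u) ω
            - ∑ i ∈ Finset.range n, A i 0 ω|} from fun ω ⟨u, hu, hω⟩ =>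
          ⟨u, ⟨by linarith [hu.1], hu.2.trans hhh₁⟩, hω⟩)).trans (hmod n hn _ hX 0))
    have ht1 : t₀ + k * h' + h ∈ Icc t₀ (T + 1) := ⟨by linarith, by linarith⟩
    have hA3 := (mul_le_mul_right (hm₀ m hm₀m _ ht1) _).trans
      (hA.pathProb_mul_le_of_deficit (n := n) (m := m) (ε := ε') (κ := δ / 4) (η := η) hc ht₀
        ht₀_pos (t := t₀ + k * h' + h) (h := h) (by linarith) hh.le hmn hδm hη.le hρ.le hρ1
        (by linarith) (by linarith))
    have hA4 := (hcon (t₀ + k * h' + h) η (by linarith) hη (by nlinarith) (n + m) (by omega)).le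
    have hA5 : ENNReal.ofReal (Real.exp (-((n + m : ℕ) * (R + ε)))) ≤ D := by
      refine ENNReal.ofReal_le_ofReal (Real.exp_le_exp.2 ?_)
      have h1 : 0 ≤ (m : ℝ) * (R + ε) := by positivity
      push_cast
      linarith
    calc _ ≤ D + D + D := add_le_add (add_le_add hA1 hA2) (hA3.trans (hA4.trans hA5))
      _ = 3 * D := by ring
  have htail' : P {ω | ∃ t, T ≤ t ∧ n * c₂ * t < |∑ i ∈ Finset.range n, A i (-t) ω|} ≤ D :=
    (measure_mono (show {ω | ∃ t, T ≤ t ∧ n * c₂ * t < |∑ i ∈ Finset.range n, A i (-t) ω|} ⊆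
        {ω | ∃ t, T₁ ≤ t ∧ n * c₂ * t < |∑ i ∈ Finset.range n, A i (-t) ω|} from
      fun ω ⟨t, ht, hω⟩ => ⟨t, (le_max_left _ _).trans ht, hω⟩)).trans (htail n hn _ hX)
  have htotal : ENNReal.ofReal (Real.exp (-(n * R))) * ENNReal.ofReal (Real.exp (-(m * K)))
      ≤ (1 + (L + 1) * 3 : ℕ) * D := by
    refine (mul_le_mul_left (hnR.trans
      (hA.measure_Q2_le_sum hv hg hb hc₂ hc hn hh' (T := T) (L := L) le_rfl)) _).trans ?_
    rw [add_mul, Finset.sum_mul]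
    have hexp : ENNReal.ofReal (Real.exp (-(m * K))) ≤ 1 :=
      ENNReal.ofReal_le_one.2 (Real.exp_le_one_iff.2 (neg_nonpos.2 (by positivity)))
    refine (add_le_add ((mul_le_of_le_one_right' hexp).trans htail')
      (Finset.sum_le_card_nsmul _ _ _ hcell)).trans_eq ?_
    rw [Finset.card_range, nsmul_eq_mul]
    push_cast
    ring
  rw [hD, ← ENNReal.ofReal_natCast, ← ENNReal.ofReal_mul (Real.exp_pos _).le,
    ← ENNReal.ofReal_mul (Nat.cast_nonneg _), ENNReal.ofReal_le_ofReal_iff (by positivity),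
    ← Real.exp_add] at htotal
  have hmK : (m : ℝ) * K ≤ n * (ε / 2) + K := by
    have h1 := mul_le_mul_of_nonneg_right hmδ.le hK.le
    have h2 := mul_le_mul_of_nonneg_left hδK (Nat.cast_nonneg (α := ℝ) n)
    linarith
  have h1 : Real.exp (n * (ε / 2)) * Real.exp (-(n * (R + ε))) * Real.exp (-K)
      ≤ (1 + (L + 1) * 3 : ℕ) * Real.exp (-(n * (R + ε))) := by
    refine le_trans ?_ htotal
    rw [← Real.exp_add, ← Real.exp_add]
    refine Real.exp_le_exp.2 ?_
    linarith
  have h2 : Real.exp (n * (ε / 2)) * Real.exp (-K) ≤ (1 + (L + 1) * 3 : ℕ) := by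
    have := Real.exp_pos (-(n * (R + ε)))
    refine le_of_mul_le_mul_right ?_ this
    linarith
  rw [Real.exp_neg, ← div_eq_mul_inv, div_le_iff₀ (Real.exp_pos K)] at h2
  linarith

end IsIIDGaussianSources

end Tandem

/-! ### Existence of the decay rate and conclusion -/

namespace Tandem

/-- A sequence has a decay rate if exponential lower bounds that hold frequently with some rate
hold eventually with every larger rate. -/
lemma isDecayRate_sInf {p : ℕ → ENNReal}
    (hfreq : ∀ R R' : ℝ, R < R' → (∃ᶠ n : ℕ in atTop, ENNReal.ofReal (Real.exp (-(n * R))) ≤ p n) →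
      ∀ᶠ n : ℕ in atTop, ENNReal.ofReal (Real.exp (-(n * R'))) ≤ p n)
    (hne : {R : ℝ | ∀ᶠ n : ℕ in atTop, ENNReal.ofReal (Real.exp (-(n * R))) ≤ p n}.Nonempty)
    (hbdd : BddBelow {R : ℝ | ∀ᶠ n : ℕ in atTop, ENNReal.ofReal (Real.exp (-(n * R))) ≤ p n}) :
    IsDecayRate p
      (sInf {R : ℝ | ∀ᶠ n : ℕ in atTop, ENNReal.ofReal (Real.exp (-(n * R))) ≤ p n}) := by
  set S := {R : ℝ | ∀ᶠ n : ℕ in atTop, ENNReal.ofReal (Real.exp (-(n * R))) ≤ p n}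
  have hlog : ∀ (n : ℕ) (R : ℝ), 1 ≤ n →
      ENNReal.log (ENNReal.ofReal (Real.exp (-(n * R)))) = ((-R : ℝ) : EReal) * (n : EReal) := by
    intro n R hn
    rw [ENNReal.log_ofReal_of_pos (Real.exp_pos _), Real.log_exp, ← EReal.coe_coe_eq_natCast,
      ← EReal.coe_mul]
    congr 1
    ring
  have hmul : ∀ (n : ℕ), 1 ≤ n → (0 : EReal) < (n : EReal) := by
    intro n hn
    exact_mod_cast hn
  have htop : ∀ (n : ℕ), (n : EReal) ≠ ⊤ := EReal.natCast_ne_top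
  refine tendsto_order.2 ⟨fun a ha => ?_, fun a ha => ?_⟩
  · obtain ⟨R, haR, hRJ⟩ := EReal.lt_iff_exists_real_btwn.1 ha
    have hRJ' : R < sInf S := by exact_mod_cast hRJ
    have h1 : ¬∃ᶠ n : ℕ in atTop, ENNReal.ofReal (Real.exp (-(n * R))) ≤ p n := by
      intro h
      -- A frequent lower bound at R < inf S would put this midpoint, still below inf S, into S.
      have h2 : (R + sInf S) / 2 ∈ S := hfreq R _ (by linarith) h
      have := csInf_le hbdd h2
      linarith
    filter_upwards [not_frequently.1 h1, eventually_ge_atTop 1] with n hn hn1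
    refine haR.trans_le ?_
    rw [EReal.le_neg, ← EReal.coe_neg, EReal.div_le_iff_le_mul (hmul n hn1) (htop n), mul_comm,
      ← hlog n R hn1]
    exact ENNReal.log_monotone (not_le.1 hn).le
  · obtain ⟨R, hJR, hRa⟩ := EReal.lt_iff_exists_real_btwn.1 ha
    have hJR' : sInf S < R := by exact_mod_cast hJR
    obtain ⟨R₁, hR₁, hR₁R⟩ := exists_lt_of_csInf_lt hne hJR'
    have h1 : ∀ᶠ n : ℕ in atTop, ENNReal.ofReal (Real.exp (-(n * R))) ≤ p n :=
      hfreq R₁ R hR₁R (Eventually.frequently hR₁)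
    filter_upwards [h1, eventually_ge_atTop 1] with n hn hn1
    refine lt_of_le_of_lt ?_ hRa
    rw [EReal.neg_le, ← EReal.coe_neg, EReal.le_div_iff_mul_le (hmul n hn1) (htop n),
      ← hlog n R hn1]
    exact ENNReal.log_monotone hn

lemma nonneg_of_frequently_exp_le {p : ℕ → ENNReal} (hp : ∀ n, p n ≤ 1) {R : ℝ}
    (h : ∃ᶠ n : ℕ in atTop, ENNReal.ofReal (Real.exp (-(n * R))) ≤ p n) : 0 ≤ R := by
  obtain ⟨n, hn, hn1⟩ := (h.and_eventually (eventually_ge_atTop 1)).exists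
  have h1 := ENNReal.ofReal_le_one.1 (hn.trans (hp n))
  rw [Real.exp_le_one_iff, neg_nonpos] at h1
  have h2 : (0 : ℝ) < n := by exact_mod_cast hn1
  exact nonneg_of_mul_nonneg_right h1 h2

variable {Ω : Type*} [MeasurableSpace Ω] {P : Measure Ω} [IsProbabilityMeasure P] {v : ℝ → ℝ}
  {A : ℕ → ℝ → Ω → ℝ} {b c₁ c₂ : ℝ}

namespace IsIIDGaussianSources

/-- The decay rate of the overflow probability of the second queue. -/
theorem exists_isDecayRate (hA : IsIIDGaussianSources P v A) (hv : RegularVariance v)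
    (hg : SubquadraticGrowth v) (hb : 0 < b) (hc₂ : 0 < c₂) (hc : c₂ < c₁) :
    ∃ J : ℝ, IsDecayRate (fun n => P {ω | n * b < Q2 A c₁ c₂ n ω}) J ∧
      (⨅ t ∈ Ioi (b / (c₁ - c₂)), ⨆ s ∈ Ioo 0 t, ((Ups v b c₁ c₂ s t : ℝ) : EReal))
        ≤ (J : EReal) := by
  set p : ℕ → ENNReal := fun n => P {ω | n * b < Q2 A c₁ c₂ n ω}
  set S := {R : ℝ | ∀ᶠ n : ℕ in atTop, ENNReal.ofReal (Real.exp (-(n * R))) ≤ p n} with hS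
  have hp : ∀ n, p n ≤ 1 := fun n => prob_le_one
  have hd : 0 < c₁ - c₂ := sub_pos.2 hc
  have hfreq : ∀ R R' : ℝ, R < R' →
      (∃ᶠ n : ℕ in atTop, ENNReal.ofReal (Real.exp (-(n * R))) ≤ p n) →
      ∀ᶠ n : ℕ in atTop, ENNReal.ofReal (Real.exp (-(n * R'))) ≤ p n := by
    intro R R' hRR' h
    have hR := nonneg_of_frequently_exp_le hp h
    obtain ⟨t, η, ht, hη0, hη, N, hN, hq⟩ := hA.exists_exp_le_pathProb_of_frequently hv hg hb hc₂ hc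
      hR (show 0 < (R' - R) / 2 by linarith) h
    exact hA.eventually_exp_le_measure_Q2 hv hg hb hc₂ hc ht hη0 hη hN (by linarith)
      (by linarith) hq
  have hne : S.Nonempty := by
    have ht : b / (c₁ - c₂) < b / (c₁ - c₂) + 1 := by linarith
    have hη : (c₁ - c₂) / 2 < (c₁ - c₂) * (b / (c₁ - c₂) + 1 - b / (c₁ - c₂)) := by
      rw [add_sub_cancel_left]
      linarith
    obtain ⟨K, hK, m₀, hm⟩ := hA.exists_exp_le_pathProb_queue hv hb hc₂ hc ht hη
    exact ⟨K + 1, hA.eventually_exp_le_measure_Q2 hv hg hb hc₂ hc ht (by linarith) hη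
      (le_max_left 1 m₀) hK.le (by linarith) (hm _ (le_max_right 1 m₀))⟩
  have hbdd : BddBelow S := ⟨0, fun R (hR : ∀ᶠ n : ℕ in atTop, _) =>
    nonneg_of_frequently_exp_le hp hR.frequently⟩
  refine ⟨sInf S, isDecayRate_sInf hfreq hne hbdd, ?_⟩
  refine EReal.le_of_forall_lt_iff_le.1 fun z hz => ?_
  have hz' : sInf S < z := by exact_mod_cast hz
  obtain ⟨R, hR, hRz⟩ := exists_lt_of_csInf_lt hne hz'
  have hR' : ∃ᶠ n : ℕ in atTop, ENNReal.ofReal (Real.exp (-(n * R))) ≤ p n :=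
    Eventually.frequently hR
  obtain ⟨t, η, ht, hη0, hη, N, hN, hq⟩ := hA.exists_exp_le_pathProb_of_frequently hv hg hb hc₂ hc
      (nonneg_of_frequently_exp_le hp hR') (sub_pos.2 hRz) hR'
  -- One t serves every s. Since the Chernoff bound has no prefactor, comparing exponents at the
  -- single N gives Υ(s, t) ≤ z.
  refine iInf₂_le_of_le t ht (iSup₂_le fun s hs => ?_)
  have hN' : (0 : ℝ) < N := by exact_mod_cast hN
  have h1 := hq.trans ((pathProb_anti fun s _ => mul_le_mul_of_nonneg_left
    (show b + c₂ * t - c₁ * s ≤ b + c₂ * t - c₁ * s + η by linarith) hN'.le).trans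
      (hA.pathProb_le_exp_Ups hv hb hc₂ hc ht hs N))
  rw [ENNReal.ofReal_le_ofReal_iff (Real.exp_pos _).le, Real.exp_le_exp, neg_le_neg_iff,
    add_sub_cancel, mul_le_mul_iff_right₀ hN'] at h1
  exact_mod_cast h1

end IsIIDGaussianSources

end Tandem

theorem corollary3p5 {Ω : Type*} [MeasurableSpace Ω] (P : Measure Ω) [IsProbabilityMeasure P]
    (v : ℝ → ℝ) (A : ℕ → ℝ → Ω → ℝ) (b c₁ c₂ : ℝ)
    (hb : 0 < b) (hc₂ : 0 < c₂) (hc : c₂ < c₁)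
    (hA : Tandem.IsIIDGaussianSources P v A)
    (hgrowth : Tandem.SubquadraticGrowth v)
    (hv : Tandem.RegularVariance v) :
    (∀ t : ℝ, b / (c₁ - c₂) < t → ∀ s ∈ Ioo 0 t,
      (⨅ f ∈ Tandem.pathSetU b c₁ c₂ s t, Tandem.rate v f)
        = ((Tandem.Ups v b c₁ c₂ s t : ℝ) : EReal)) ∧
    ∃ J : ℝ, Tandem.IsDecayRate (fun n => P {ω | n * b < Tandem.Q2 A c₁ c₂ n ω}) J ∧
      (⨅ t ∈ Ioi (b / (c₁ - c₂)), ⨆ s ∈ Ioo 0 t, ((Tandem.Ups v b c₁ c₂ s t : ℝ) : EReal))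
        ≤ (J : EReal) :=
  ⟨fun _ ht _ hs => ((hA.source 0).isScaledSource (hA.aemeasurable 0)).iInf_rate_eq
    (hA.source 0).v_zero hgrowth hv hb hc₂ hc ht hs,
    hA.exists_isDecayRate hv hgrowth hb hc₂ hc⟩
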